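/- Let $k>2$ be an integer, let $H(x,\xi)=\xi^2\pm x^k$ on $\mathbb R^2$ (with either choice of sign), and work either in the $C^\infty$-smooth or in the real-analytic category. Let $\omega$ be a symplectic form (smooth, respectively real-analytic) on a neighbourhood of the origin in $\mathbb R^2$, and let $\varphi=(\varphi_x,\varphi_\xi)$ be a smooth (respectively real-analytic) diffeomorphism germ at the origin with $\varphi(0)=0$, $\varphi^*\omega=\omega$ and $H\circ\varphi=H$ near the origin. Let $\mathrm{Inv}(x,\xi)=(-x,-\xi)$. For a function $g$ near the origin, the flow of $g$ is the flow of its Hamiltonian vector field $X_g$ with respect to $\omega$, given by $i_{X_g}\omega=dg$, and a germ $\psi$ is the time-one map of this flow if, for some open neighbourhood $V$ of $0$ on which $\omega$ and $g$ are defined, for every $z$ near $0$ the integral curve of $X_g$ starting at $z$ exists in $V$ on $[0,1]$ and is at $\psi(z)$ at time $1$. 1. If $k$ is odd, then $\varphi$ is the time-one map of the flow of a function of $H$, that is, of $g=G\circ H$ for a smooth (respectively real-analytic) function $G$ of one variable defined near $0$. 2. Suppose that $k$ is even. (a) If $\mathrm{Inv}^*\omega=\omega$ near the origin, then $\varphi$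 or $\varphi\circ\mathrm{Inv}$ is the time-one map of the flow of a smooth (respectively real-analytic) function $g$, on a neighbourhood $V$ of the origin, that is constant on the connected components of the level sets of $H|_V$. (b) For arbitrary $\omega$, if $\partial_x\varphi_x(0)>0$, then $\varphi$ itself is the time-one map of the flow of such a function. -/

import Mathlib

open Set Filter Topology
open scoped ContDiff

namespace AkSingularity

/-- A differential 2-form on the plane; a point is a pair `(x, ξ)`. -/
abbrev TwoForm : Type := ℝ × ℝ → (ℝ × ℝ) [⋀^Fin 2]→L[ℝ] ℝ

/-- The pull-back of a 2-form under a map of the plane. -/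
noncomputable def pullback (φ : ℝ × ℝ → ℝ × ℝ) (Ω : TwoForm) : TwoForm :=
  fun z => (Ω (φ z)).compContinuousLinearMap (fderiv ℝ φ z)

/-- On the set `V` the 2-form `Ω` is of class `C^r`, closed and non-degenerate. -/
def IsSymplecticOn (r : WithTop ℕ∞) (Ω : TwoForm) (V : Set (ℝ × ℝ)) : Prop :=
  ContDiffOn ℝ r Ω V ∧ (∀ z ∈ V, extDeriv Ω z = 0) ∧
    ∀ z ∈ V, ∀ v : ℝ × ℝ, (∀ w : ℝ × ℝ, Ω z ![v, w] = 0) → v = 0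

/-- The Hamiltonian `H(x, ξ) = ξ² + s xᵏ`, to be used with `s = 1` or `s = -1`. -/
def ham (s : ℝ) (k : ℕ) (z : ℝ × ℝ) : ℝ := z.2 ^ 2 + s * z.1 ^ k

/-- The involution `(x, ξ) ↦ (-x, -ξ)`. -/
def inv (z : ℝ × ℝ) : ℝ × ℝ := (-z.1, -z.2)

/-- `X` is the Hamiltonian vector field of `g` on `V`: `i_X Ω = dg`. (The opposite sign convention
amounts to replacing `g` by `-g`.) -/
def IsHamVectorFieldOn (Ω : TwoForm) (g : ℝ × ℝ → ℝ) (X : ℝ × ℝ → ℝ × ℝ) (V : Set (ℝ × ℝ)) :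
    Prop :=
  ∀ z ∈ V, ∀ v : ℝ × ℝ, Ω z ![X z, v] = fderiv ℝ g z v

/-- Near the origin, `φ` is the time-one map of the flow in `V` of the Hamiltonian vector field of
`g`: for every `z` near the origin, the integral curve that starts at `z` exists in `V` up to time
`1`, where it is at `φ z`. It is used with `V` open, `Ω` symplectic on `V` and `g` of class at
least `C^∞` on `V`, so that vector field and integral curves are unique. -/
def IsTimeOneMap (Ω : TwoForm) (g : ℝ × ℝ → ℝ) (V : Set (ℝ × ℝ)) (φ : ℝ × ℝ → ℝ × ℝ) : Prop :=
  ∃ X : ℝ × ℝ → ℝ × ℝ, IsHamVectorFieldOn Ω g X V ∧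
    ∀ᶠ z in 𝓝 (0 : ℝ × ℝ), ∃ γ : ℝ → ℝ × ℝ, γ 0 = z ∧ γ 1 = φ z ∧
      ∀ t ∈ Icc (0 : ℝ) 1, γ t ∈ V ∧ HasDerivWithinAt γ (X (γ t)) (Icc 0 1) t

/-- Near the origin, `φ` is the time-one map of the flow of `G ∘ H` for a function `G` of one
variable of class `C^r`. -/
def IsTimeOneMapOfFunctionOf (r : WithTop ℕ∞) (Ω : TwoForm) (H : ℝ × ℝ → ℝ)
    (φ : ℝ × ℝ → ℝ × ℝ) : Prop :=
  ∃ V : Set (ℝ × ℝ), IsOpen V ∧ (0 : ℝ × ℝ) ∈ V ∧ IsSymplecticOn r Ω V ∧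
    ∃ (J : Set ℝ) (G : ℝ → ℝ), IsOpen J ∧ MapsTo H V J ∧ ContDiffOn ℝ r G J ∧
      IsTimeOneMap Ω (G ∘ H) V φ

/-- Near the origin, `φ` is the time-one map of the flow of a function of class `C^r` that is
constant on the connected components of the level sets of `H`. -/
def IsTimeOneMapOfComponentwiseConst (r : WithTop ℕ∞) (Ω : TwoForm) (H : ℝ × ℝ → ℝ)
    (φ : ℝ × ℝ → ℝ × ℝ) : Prop :=
  ∃ V : Set (ℝ × ℝ), IsOpen V ∧ (0 : ℝ × ℝ) ∈ V ∧ IsSymplecticOn r Ω V ∧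
    ∃ g : ℝ × ℝ → ℝ, ContDiffOn ℝ r g V ∧
      (∀ p ∈ V, ∀ q ∈ connectedComponentIn (V ∩ H ⁻¹' {H p}) p, g q = g p) ∧
      IsTimeOneMap Ω g V φ

end AkSingularity

/-! Write `X = H_ξ ∂_x - H_x ∂_ξ` and `ω = f dx ∧ dξ`. The plan is to join `φ` to the identity by
maps that move points along `X`, and to read off a generating function from the time that this
takes.

Since `k > 2`, `H ∘ φ = H` makes `dφ(0)` upper triangular, and `φ^* ω = ω` gives it determinant 1.
So `∂_x φ_x(0) ≠ 0`; it is positive if `k` is odd, and for even `k` composition with `Inv` changes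
its sign. Suppose that it is positive. With `P(x, y) = (y^k - x^k) / (y - x)`, `H ∘ φ = H` reads
`(φ_ξ - ξ)(φ_ξ + ξ) = -s P(x, φ_x)(φ_x - x)`. The function `φ_ξ + ξ` can serve as a coordinate, and
`φ_x - x` vanishes on its zero set, hence is divisible by it, with a quotient `σ` (`exists_factor`).
Replacing `σ` by `θ σ` and solving the resulting equations gives maps `Q_θ` from the identity to `φ`
that preserve `H` and have velocity `σ ν X` with `ν > 0` (`exists_family`).

Put `μ = σ ν` and `τ = ∫ μ f(Q_θ) dθ` over `[0, 1]`. Integrating `d/dθ Q_θ^* ω = d(μ f(Q_θ)) ∧ dH`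
yields `dτ ∧ dH = φ^* ω - ω = 0` (`exists_isFirstIntegralOn_time`). So `τ dH` is closed; a primitive
`g` has Hamiltonian field `(τ / f) X`. As `τ` is constant along each curve `θ ↦ Q_θ(z)`, a change of
the variable `θ` turns this curve into an integral curve of that field over the time `[0, 1]`
(`exists_generator`).

The constancy rests on two facts: a first integral has differential `l dH` with `l` again a first
integral of the same class, and a function with such a differential is constant on connected subsets
of level sets (`exists_forall_isPreconnected_eq`, a Sard-type argument). For odd `k` the level sets
near the origin are arcs, so that `g = G ∘ H`. In the smooth case `G' ∘ H = l`, which allows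
induction; in the analytic case `G` comes from the even function `ξ ↦ g(0, ξ)`, as `H = ξ²` on that
axis. -/

namespace AkSingularity

/-! ### Smooth and analytic dependence of integrals on parameters. -/

section ParametricIntegral

variable {E G : Type} [NormedAddCommGroup E] [NormedSpace ℝ E]
  [NormedAddCommGroup G] [NormedSpace ℝ G]

/-- Tube lemma for the compact interval. The order `∞` is excluded because being `C^∞` at a point is
not an open condition. -/
theorem eventually_forall_contDiffAt {n : WithTop ℕ∞} (hn : n ≠ ∞) {F : ℝ × E → G} {z₀ : E}
    (h : ∀ t ∈ Icc (0 : ℝ) 1, ContDiffAt ℝ n F (t, z₀)) :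
    ∀ᶠ z in 𝓝 z₀, ∀ t ∈ Icc (0 : ℝ) 1, ContDiffAt ℝ n F (t, z) := by
  have : ∀ᶠ z in 𝓝 z₀, ∀ t ∈ Icc (0 : ℝ) 1, ContDiffAt ℝ n F (z, t).swap := by
    refine isCompact_Icc.eventually_forall_of_forall_eventually fun t ht => ?_
    have h1 := (h t ht).eventually hn
    have h2 : Tendsto (Prod.swap : E × ℝ → ℝ × E) (𝓝 (z₀, t)) (𝓝 (t, z₀)) :=
      continuous_swap.tendsto _
    exact h2.eventually h1
  simpa using this

/-- Differentiation under the integral sign; compactness of `[0, 1]` supplies a constant as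
dominating function. -/
theorem hasFDerivAt_integral_zero_one {F : ℝ × E → G} {z₀ : E}
    (h : ∀ t ∈ Icc (0 : ℝ) 1, ContDiffAt ℝ 1 F (t, z₀)) :
    HasFDerivAt (fun z => ∫ t in (0 : ℝ)..1, F (t, z))
      (∫ t in (0 : ℝ)..1, (fderiv ℝ F (t, z₀)).comp (ContinuousLinearMap.inr ℝ ℝ E)) z₀ := by
  have hev := eventually_forall_contDiffAt (by decide) h
  have hU : uIcc (0 : ℝ) 1 = Icc 0 1 := uIcc_of_le zero_le_one
  have hU' : Set.uIoc (0 : ℝ) 1 ⊆ Icc 0 1 := by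
    rw [uIoc_of_le zero_le_one]; exact Ioc_subset_Icc_self
  have hcont : ∀ z, (∀ t ∈ Icc (0 : ℝ) 1, ContDiffAt ℝ 1 F (t, z)) →
      ContinuousOn (fun t => F (t, z)) (Icc 0 1) := fun z hz t ht =>
    ((hz t ht).continuousAt.comp (f := fun t : ℝ => (t, z)) (by fun_prop)).continuousWithinAt
  have hcd : ∀ t ∈ Icc (0 : ℝ) 1, ContinuousAt (fderiv ℝ F) (t, z₀) := fun t ht =>
    ((h t ht).fderiv_right (m := 0) (by simp)).continuousAt
  have hbd : ∃ C : ℝ, ∀ᶠ z in 𝓝 z₀, ∀ t ∈ Icc (0 : ℝ) 1, ‖fderiv ℝ F (t, z)‖ ≤ C := by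
    have hc : ContinuousOn (fun t => ‖fderiv ℝ F (t, z₀)‖) (Icc (0 : ℝ) 1) := fun t ht =>
      ((hcd t ht).comp (f := fun t : ℝ => (t, z₀)) (by fun_prop)).norm.continuousWithinAt
    obtain ⟨C, hC⟩ := isCompact_Icc.exists_bound_of_continuousOn hc
    refine ⟨C + 1, ?_⟩
    have : ∀ᶠ z in 𝓝 z₀, ∀ t ∈ Icc (0 : ℝ) 1, ‖fderiv ℝ F ((z, t) : E × ℝ).swap‖ ≤ C + 1 := by
      refine isCompact_Icc.eventually_forall_of_forall_eventually fun t ht => ?_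
      have h2 : Tendsto (fun p : E × ℝ => ‖fderiv ℝ F p.swap‖) (𝓝 (z₀, t))
          (𝓝 ‖fderiv ℝ F (t, z₀)‖) :=
        ((hcd t ht).tendsto.comp (continuous_swap.tendsto (z₀, t))).norm
      have h3 : ‖fderiv ℝ F (t, z₀)‖ < C + 1 := by
        have := hC t ht
        rw [norm_norm] at this
        linarith
      exact (h2.eventually (gt_mem_nhds h3)).mono fun _ h => le_of_lt h
    simpa using this
  obtain ⟨C, hC⟩ := hbd
  refine intervalIntegral.hasFDerivAt_integral_of_dominated_of_fderiv_le
    (F := fun z t => F (t, z)) (bound := fun _ => C)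
    (F' := fun z t => (fderiv ℝ F (t, z)).comp (ContinuousLinearMap.inr ℝ ℝ E))
    (hev.and hC) ?_ ?_ ?_ ?_ ?_ ?_
  · filter_upwards [hev] with z hz
    exact ((hcont z hz).mono hU').aestronglyMeasurable measurableSet_uIoc
  · exact ((hcont z₀ h).mono hU.subset).intervalIntegrable
  · refine ContinuousOn.aestronglyMeasurable (fun t ht => ?_) measurableSet_uIoc
    have := (hcd t (hU' ht)).comp (f := fun t : ℝ => (t, z₀)) (by fun_prop)
    exact (this.clm_comp continuousAt_const).continuousWithinAt
  · refine Eventually.of_forall fun t ht z hz => ?_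
    refine (ContinuousLinearMap.opNorm_comp_le _ _).trans ?_
    calc _ ≤ ‖fderiv ℝ F (t, z)‖ * 1 := by
          gcongr
          exact ContinuousLinearMap.norm_inr_le_one ℝ ℝ E
      _ ≤ C := by simpa using hz.2 t (hU' ht)
  · exact intervalIntegrable_const
  · refine Eventually.of_forall fun t ht z hz => ?_
    have h1 := ((hz.1 t (hU' ht)).differentiableAt (by simp)).hasFDerivAt
    exact h1.comp z (hasFDerivAt_prodMk_right t z)

/-- The derivative is again a parametric integral, now with values in a space of linear maps; hence
the target space is generalized in the induction. -/
theorem contDiffAt_integral_zero_one_nat (n : ℕ) : ∀ {G : Type} [NormedAddCommGroup G]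
    [NormedSpace ℝ G] {F : ℝ × E → G} {z₀ : E},
    (∀ t ∈ Icc (0 : ℝ) 1, ContDiffAt ℝ n F (t, z₀)) →
    ContDiffAt ℝ n (fun z => ∫ t in (0 : ℝ)..1, F (t, z)) z₀ := by
  induction n with
  | zero =>
    intro G _ _ F z₀ h
    have hev := eventually_forall_contDiffAt (by decide) h
    obtain ⟨u, hu, hzu, hmem⟩ := eventually_nhds_iff.1 hev
    refine contDiffAt_zero.2 ⟨u, hzu.mem_nhds hmem, ?_⟩
    refine continuousOn_iff_continuous_domRestrict.2 ?_
    have hc : ContinuousOn (fun p : ℝ × u => F (p.1, p.2)) (Icc 0 1 ×ˢ univ) := by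
      rintro ⟨t, z⟩ ⟨ht, -⟩
      exact ((hu z z.2 t ht).continuousAt.comp (f := fun p : ℝ × u => (p.1, (p.2 : E)))
        (by fun_prop)).continuousWithinAt
    -- Projecting `t` to `[0, 1]` makes the integrand continuous for all real `t` without changing
    -- the integral.
    have hpi : ∀ t : ℝ, ((projIcc (0 : ℝ) 1 zero_le_one t : Icc (0 : ℝ) 1) : ℝ) ∈ Icc (0 : ℝ) 1 :=
      fun t => (projIcc (0 : ℝ) 1 zero_le_one t).2
    have hc' : Continuous fun p : u × ℝ =>
        F (((projIcc (0 : ℝ) 1 zero_le_one p.2 : Icc (0 : ℝ) 1) : ℝ), (p.1 : E)) := by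
      refine hc.comp_continuous
        (f := fun p : u × ℝ => (((projIcc (0 : ℝ) 1 zero_le_one p.2 : Icc (0 : ℝ) 1) : ℝ), p.1))
        ?_ fun p => ⟨hpi p.2, mem_univ _⟩
      have := continuous_projIcc (a := (0 : ℝ)) (b := 1) (h := zero_le_one)
      fun_prop
    have := intervalIntegral.continuous_parametric_intervalIntegral_of_continuous'
      (μ := MeasureTheory.volume) (f := fun (z : u) t =>
        F (((projIcc (0 : ℝ) 1 zero_le_one t : Icc (0 : ℝ) 1) : ℝ), (z : E))) hc' 0 1
    refine this.congr fun z => intervalIntegral.integral_congr fun t ht => ?_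
    rw [uIcc_of_le zero_le_one] at ht
    simp only [projIcc_of_mem _ ht]
  | succ n ih =>
    intro G _ _ F z₀ h
    have h1 : ∀ t ∈ Icc (0 : ℝ) 1, ContDiffAt ℝ 1 F (t, z₀) := fun t ht =>
      (h t ht).of_le (by exact_mod_cast Nat.le_add_left 1 n)
    have hev := eventually_forall_contDiffAt (by decide) h1
    push_cast
    refine contDiffAt_succ_iff_hasFDerivAt.2 ⟨_, ⟨_, hev, fun z hz =>
      hasFDerivAt_integral_zero_one hz⟩, ?_⟩
    refine ih (F := fun p : ℝ × E => (fderiv ℝ F p).comp (ContinuousLinearMap.inr ℝ ℝ E))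
      fun t ht => ?_
    exact ((h t ht).fderiv_right (m := n) (by push_cast; exact le_rfl)).clm_comp contDiffAt_const

/-- The power series of `F` at `(t₀, z₀)` is re-expanded at `(t, z₀)` for `t` near `t₀`. The
coefficients depend continuously on `t` and have a summable bound uniform in `t`, so that the series
may be integrated term by term. -/
theorem exists_analyticAt_intervalIntegral [CompleteSpace G] {F : ℝ × E → G} {t₀ : ℝ} {z₀ : E}
    (h : AnalyticAt ℝ F (t₀, z₀)) :
    ∃ ε > 0, ∀ a b : ℝ, |a - t₀| < ε → |b - t₀| < ε →
      AnalyticAt ℝ (fun z => ∫ t in a..b, F (t, z)) z₀ := by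
  obtain ⟨p, R, hf⟩ := h
  obtain ⟨r, hr0, hrR⟩ := ENNReal.lt_iff_exists_nnreal_btwn.1 hf.r_pos
  have hr0 : 0 < r := by exact_mod_cast hr0
  -- Half the radius, so that a shift of the centre by `ρ` still leaves room for an increment of
  -- size `ρ`.
  set ρ : NNReal := r / 2 with hρ
  have hρ0 : 0 < ρ := by positivity
  have hρρ : (ρ : ENNReal) + ρ < R := by
    rw [← ENNReal.coe_add, hρ, add_halves]; exact hrR
  have hrad : (ρ : ENNReal) + ρ < p.radius := hρρ.trans_le hf.r_le
  refine ⟨ρ, by exact_mod_cast hρ0, fun a b ha hb => ?_⟩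
  have hab : ∀ t ∈ uIcc a b, |t - t₀| < ρ := by
    intro t ht
    have ha' := abs_lt.1 ha
    have hb' := abs_lt.1 hb
    rcases le_total a b with hle | hle
    · rw [uIcc_of_le hle] at ht
      exact abs_lt.2 ⟨by linarith [ht.1], by linarith [ht.2]⟩
    · rw [uIcc_of_ge hle] at ht
      exact abs_lt.2 ⟨by linarith [ht.1], by linarith [ht.2]⟩
  have hnn : ∀ t ∈ uIcc a b, ‖((t - t₀, 0) : ℝ × E)‖₊ ≤ ρ := by
    intro t ht
    rw [← NNReal.coe_le_coe]
    simpa [Prod.norm_def] using (hab t ht).le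
  set c : ℝ → FormalMultilinearSeries ℝ E G := fun t n =>
    ((p.changeOrigin (t - t₀, 0)) n).compContinuousLinearMap
      (fun _ => ContinuousLinearMap.inr ℝ ℝ E) with hc
  set M : ℕ → NNReal := fun n =>
    ∑' s : Σ l : ℕ, { s : Finset (Fin (n + l)) // s.card = l }, ‖p (n + s.1)‖₊ * ρ ^ s.1 with hM
  have hMs : Summable fun n => M n * ρ ^ n := by
    simpa only [hM, ← NNReal.tsum_mul_right] using
      (NNReal.summable_sigma.1 (p.changeOriginSeries_summable_aux₁ hrad)).2
  have hρp : (ρ : ENNReal) < p.radius := (le_self_add).trans_lt hrad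
  have hcM : ∀ t ∈ uIcc a b, ∀ n, ‖c t n‖ ≤ M n := by
    intro t ht n
    have hlt : (‖((t - t₀, 0) : ℝ × E)‖₊ : ENNReal) < p.radius :=
      (ENNReal.coe_le_coe.2 (hnn t ht)).trans_lt hρp
    have h1 := p.nnnorm_changeOrigin_le n hlt
    have h2 : (∑' s : Σ l : ℕ, { s : Finset (Fin (n + l)) // s.card = l },
        ‖p (n + s.1)‖₊ * ‖((t - t₀, 0) : ℝ × E)‖₊ ^ s.1) ≤ M n := by
      refine Summable.tsum_le_tsum (fun s => ?_) (p.changeOriginSeries_summable_aux₂ hlt n)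
        (p.changeOriginSeries_summable_aux₂ hρp n)
      gcongr
      exact hnn t ht
    have h3 : ‖c t n‖ ≤ ‖p.changeOrigin (t - t₀, 0) n‖ := by
      refine (ContinuousMultilinearMap.norm_compContinuousLinearMap_le _ _).trans ?_
      refine mul_le_of_le_one_right (norm_nonneg _) ?_
      exact Finset.prod_le_one (fun _ _ => norm_nonneg _)
        fun _ _ => ContinuousLinearMap.norm_inr_le_one ℝ ℝ E
    exact h3.trans (by exact_mod_cast h1.trans h2)
  have hcc : ∀ n, ContinuousOn (fun t => c t n) (uIcc a b) := by
    intro n t ht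
    have hlt : (‖((t - t₀, 0) : ℝ × E)‖₊ : ENNReal) < p.radius :=
      (ENNReal.coe_le_coe.2 (hnn t ht)).trans_lt hρp
    have h0 := (p.hasFPowerSeriesOnBall_changeOrigin n (zero_le.trans_lt hρp)).continuousOn
    have h1 : ContinuousAt (fun x => p.changeOrigin x n) ((t - t₀, 0) : ℝ × E) :=
      h0.continuousAt (Metric.isOpen_eball.mem_nhds (by
        rw [mem_eball_zero_iff]; exact hlt))
    have h2 : ContinuousAt (fun t : ℝ => p.changeOrigin ((t - t₀, 0) : ℝ × E) n) t :=
      h1.comp (f := fun t : ℝ => ((t - t₀, 0) : ℝ × E)) (by fun_prop)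
    exact ((ContinuousMultilinearMap.compContinuousLinearMapL
      (fun _ : Fin n => ContinuousLinearMap.inr ℝ ℝ E)).continuous.continuousAt.comp
        h2).continuousWithinAt
  refine ⟨fun n => ∫ t in a..b, c t n, ρ, ?_, by exact_mod_cast hρ0, ?_⟩
  · refine FormalMultilinearSeries.le_radius_of_summable_norm _ ?_
    have hs : Summable fun n => ((M n * ρ ^ n : NNReal) : ℝ) * |b - a| :=
      (NNReal.summable_coe.2 hMs).mul_right _
    refine Summable.of_nonneg_of_le (fun n => by positivity) (fun n => ?_) hs
    have : ‖∫ t in a..b, c t n‖ ≤ M n * |b - a| :=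
      intervalIntegral.norm_integral_le_of_norm_le_const fun t ht =>
        hcM t (uIoc_subset_uIcc ht) n
    push_cast
    calc _ ≤ (M n * |b - a|) * (ρ : ℝ) ^ n := by gcongr
      _ = _ := by ring
  · intro y hy
    have hy' : (‖y‖₊ : ENNReal) < ρ := by
      rw [mem_eball_zero_iff] at hy; exact hy
    have hyρ : ‖y‖ ≤ ρ := by
      have : ‖y‖₊ < ρ := by exact_mod_cast hy'
      exact_mod_cast this.le
    have key : ∀ t ∈ uIcc a b, HasSum (fun n => c t n fun _ => y) (F (t, z₀ + y)) := by
      intro t ht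
      have hlt : (‖((t - t₀, 0) : ℝ × E)‖₊ : ENNReal) < R :=
        (ENNReal.coe_le_coe.2 (hnn t ht)).trans_lt (le_self_add.trans_lt hρρ)
      have h1 := (hf.changeOrigin hlt).hasSum (y := ((0 : ℝ), y)) (by
        rw [mem_eball_zero_iff, lt_tsub_iff_right]
        refine lt_of_le_of_lt ?_ hρρ
        gcongr
        · have : ‖((0 : ℝ), y)‖ₑ = (‖y‖₊ : ENNReal) := by
            change (‖((0 : ℝ), y)‖₊ : ENNReal) = _
            simp [Prod.nnnorm_def]
          rw [this]; exact hy'.le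
        · exact hnn t ht)
      have h2 : ((t₀, z₀) + (t - t₀, 0) + (0, y) : ℝ × E) = (t, z₀ + y) := by
        ext <;> simp
      rw [h2] at h1
      exact h1
    have hq : ∀ n, (∫ t in a..b, c t n) (fun _ => y) = ∫ t in a..b, c t n fun _ => y := by
      intro n
      exact ((ContinuousMultilinearMap.apply ℝ (fun _ : Fin n => E) G
        (fun _ => y)).intervalIntegral_comp_comm (hcc n).intervalIntegrable).symm
    simp only [hq]
    refine intervalIntegral.hasSum_integral_of_dominated_convergence
      (fun n _ => (M n * ρ ^ n : ℝ)) (fun n => ?_) (fun n => ?_) ?_ ?_ ?_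
    · refine ContinuousOn.aestronglyMeasurable (fun t ht => ?_) measurableSet_uIoc
      exact (((ContinuousMultilinearMap.apply ℝ (fun _ : Fin n => E) G
        (fun _ => y)).continuous.comp_continuousOn (hcc n)) t
          (uIoc_subset_uIcc ht)).mono uIoc_subset_uIcc
    · refine Eventually.of_forall fun t ht => ?_
      refine ((c t n).le_opNorm _).trans ?_
      have := hcM t (uIoc_subset_uIcc ht) n
      simp only [Finset.prod_const, Finset.card_univ, Fintype.card_fin]
      gcongr
    · exact Eventually.of_forall fun t _ => by exact_mod_cast hMs
    · exact intervalIntegrable_const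
    · exact Eventually.of_forall fun t ht => key t (uIoc_subset_uIcc ht)

/-- By compactness `[0, 1]` is a finite union of intervals on which the local statement applies. -/
theorem analyticAt_integral_zero_one [CompleteSpace G] {F : ℝ × E → G} {z₀ : E}
    (h : ∀ t ∈ Icc (0 : ℝ) 1, AnalyticAt ℝ F (t, z₀)) :
    AnalyticAt ℝ (fun z => ∫ t in (0 : ℝ)..1, F (t, z)) z₀ := by
  have hev : ∀ᶠ z in 𝓝 z₀, ContinuousOn (fun t => F (t, z)) (Icc 0 1) := by
    have := eventually_forall_contDiffAt (n := 0) (by decide) fun t ht =>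
      (h t ht).contDiffAt
    filter_upwards [this] with z hz t ht
    exact ((hz t ht).continuousAt.comp (f := fun t : ℝ => (t, z)) (by fun_prop)).continuousWithinAt
  choose ε hε hloc using fun t : Icc (0 : ℝ) 1 => exists_analyticAt_intervalIntegral (h t t.2)
  obtain ⟨u, hu0, hmono, ⟨N, hN⟩, hu⟩ := exists_monotone_Icc_subset_open_cover_Icc
    (c := fun t : Icc (0 : ℝ) 1 => {s : Icc (0 : ℝ) 1 | |(s : ℝ) - t| < ε t}) zero_le_one
    (fun t => isOpen_lt (by fun_prop) continuous_const)
    (fun t _ => mem_iUnion.2 ⟨t, by simp [hε t]⟩)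
  have step : ∀ n, AnalyticAt ℝ (fun z => ∫ t in (0 : ℝ)..(u n), F (t, z)) z₀ := by
    intro n
    induction n with
    | zero => simp only [hu0, intervalIntegral.integral_same]; exact analyticAt_const
    | succ n ih =>
      obtain ⟨t, ht⟩ := hu n
      have hle := hmono n.le_succ
      have h1 := hloc t (u n) (u (n + 1)) (ht ⟨le_rfl, hle⟩) (ht ⟨hle, le_rfl⟩)
      refine (ih.add h1).congr ?_
      filter_upwards [hev] with z hz
      refine intervalIntegral.integral_add_adjacent_intervals ?_ ?_
      · exact (hz.mono (uIcc_subset_Icc ⟨le_rfl, zero_le_one⟩ (u n).2)).intervalIntegrable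
      · exact (hz.mono (uIcc_subset_Icc (u n).2 (u (n + 1)).2)).intervalIntegrable
  have := step N
  rwa [hN N le_rfl] at this

theorem contDiffAt_integral_zero_one [CompleteSpace G] {r : WithTop ℕ∞} (hr : r = ∞ ∨ r = ω)
    {F : ℝ × E → G} {z₀ : E} (h : ∀ t ∈ Icc (0 : ℝ) 1, ContDiffAt ℝ r F (t, z₀)) :
    ContDiffAt ℝ r (fun z => ∫ t in (0 : ℝ)..1, F (t, z)) z₀ := by
  rcases hr with rfl | rfl
  · exact contDiffAt_infty.2 fun n => contDiffAt_integral_zero_one_nat n fun t ht =>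
      contDiffAt_infty.1 (h t ht) n
  · exact (analyticAt_integral_zero_one fun t ht => (h t ht).analyticAt).contDiffAt

end ParametricIntegral

/-! ### Hadamard's lemma and the Poincaré lemma. -/

section Division

variable {r : WithTop ℕ∞}

/-- Neither class loses regularity under differentiation; this lets both categories share one proof.
-/
theorem add_one_le_of_infty_or_omega (hr : r = ∞ ∨ r = ω) : r + 1 ≤ r := by
  rcases hr with rfl | rfl <;> exact le_of_eq rfl

theorem one_le_of_infty_or_omega (hr : r = ∞ ∨ r = ω) : 1 ≤ r :=
  (le_add_self).trans (add_one_le_of_infty_or_omega hr)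

theorem ne_zero_of_infty_or_omega (hr : r = ∞ ∨ r = ω) : r ≠ 0 :=
  (zero_lt_one.trans_le (one_le_of_infty_or_omega hr)).ne'

theorem smul_mem_ball_zero {E : Type*} [NormedAddCommGroup E] [NormedSpace ℝ E] {ρ t : ℝ} {z : E}
    (ht : t ∈ Icc (0 : ℝ) 1) (hz : z ∈ Metric.ball (0 : E) ρ) : t • z ∈ Metric.ball (0 : E) ρ := by
  rw [mem_ball_zero_iff] at *
  rw [norm_smul, Real.norm_of_nonneg ht.1]
  exact (mul_le_of_le_one_left (norm_nonneg _) ht.2).trans_lt hz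

theorem shrink_snd_mem_ball_zero {ρ t : ℝ} {z : ℝ × ℝ}
    (ht : t ∈ Icc (0 : ℝ) 1) (hz : z ∈ Metric.ball (0 : ℝ × ℝ) ρ) :
    (z.1, t * z.2) ∈ Metric.ball (0 : ℝ × ℝ) ρ := by
  rw [mem_ball_zero_iff] at *
  refine lt_of_le_of_lt ?_ hz
  simp only [Prod.norm_def, Real.norm_eq_abs, abs_mul, abs_of_nonneg ht.1]
  exact max_le_max le_rfl (mul_le_of_le_one_left (abs_nonneg _) ht.2)

/-- Hadamard's lemma: a function that vanishes on the first axis is divisible by the second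
coordinate. -/
theorem exists_eq_snd_mul (hr : r = ∞ ∨ r = ω) {F : ℝ × ℝ → ℝ} {ρ : ℝ}
    (hF : ∀ z ∈ Metric.ball (0 : ℝ × ℝ) ρ, ContDiffAt ℝ r F z)
    (h0 : ∀ x, (x, (0 : ℝ)) ∈ Metric.ball (0 : ℝ × ℝ) ρ → F (x, 0) = 0) :
    ∃ l : ℝ × ℝ → ℝ, (∀ z ∈ Metric.ball (0 : ℝ × ℝ) ρ, ContDiffAt ℝ r l z) ∧
      ∀ z ∈ Metric.ball (0 : ℝ × ℝ) ρ, F z = z.2 * l z := by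
  refine ⟨fun z => ∫ t in (0 : ℝ)..1, fderiv ℝ F (z.1, t * z.2) (0, 1), fun z hz => ?_,
    fun z hz => ?_⟩
  · refine contDiffAt_integral_zero_one hr
      (F := fun p : ℝ × (ℝ × ℝ) => fderiv ℝ F (p.2.1, p.1 * p.2.2) (0, 1)) fun t ht => ?_
    have h1 := (hF _ (shrink_snd_mem_ball_zero ht hz)).fderiv_right
      (add_one_le_of_infty_or_omega hr)
    have h2 : ContDiffAt ℝ r (fun p : ℝ × (ℝ × ℝ) => (p.2.1, p.1 * p.2.2)) (t, z) := by
      fun_prop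
    exact (h1.comp (t, z) h2).clm_apply contDiffAt_const
  · have hd : ∀ t ∈ uIcc (0 : ℝ) 1, HasDerivAt (fun t => F (z.1, t * z.2))
        (z.2 * fderiv ℝ F (z.1, t * z.2) (0, 1)) t := by
      intro t ht
      rw [uIcc_of_le zero_le_one] at ht
      have h1 := ((hF _ (shrink_snd_mem_ball_zero ht hz)).differentiableAt
        (ne_zero_of_infty_or_omega hr)).hasFDerivAt
      have h2 : HasDerivAt (fun t : ℝ => (z.1, t * z.2)) (0, 1 * z.2) t :=
        (hasDerivAt_const t z.1).prodMk ((hasDerivAt_id t).mul_const z.2)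
      have h3 := h1.comp_hasDerivAt t h2
      have h4 : ((0 : ℝ), 1 * z.2) = z.2 • ((0 : ℝ), (1 : ℝ)) := by ext <;> simp
      rw [h4, map_smul, smul_eq_mul] at h3
      exact h3
    have hc : ContinuousOn (fun t => z.2 * fderiv ℝ F (z.1, t * z.2) (0, 1)) (uIcc (0 : ℝ) 1) := by
      intro t ht
      rw [uIcc_of_le zero_le_one] at ht
      have h1 := ((hF _ (shrink_snd_mem_ball_zero ht hz)).fderiv_right
        (add_one_le_of_infty_or_omega hr)).continuousAt
      have h2 : ContinuousAt (fun t : ℝ => fderiv ℝ F (z.1, t * z.2)) t :=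
        h1.comp (f := fun t : ℝ => (z.1, t * z.2)) (by fun_prop)
      exact (continuousAt_const.mul (h2.clm_apply continuousAt_const)).continuousWithinAt
    have := intervalIntegral.integral_eq_sub_of_hasDerivAt hd hc.intervalIntegrable
    rw [intervalIntegral.integral_const_mul] at this
    rw [this]
    have h5 := h0 z.1 (by simpa using shrink_snd_mem_ball_zero (t := 0) ⟨le_rfl, zero_le_one⟩ hz)
    simp [h5]

/-- The Poincaré lemma for 1-forms on a ball. -/
theorem exists_primitive (hr : r = ∞ ∨ r = ω) {E : Type} [NormedAddCommGroup E] [NormedSpace ℝ E]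
    {a : E → E →L[ℝ] ℝ} {ρ : ℝ}
    (ha : ∀ z ∈ Metric.ball (0 : E) ρ, ContDiffAt ℝ r a z)
    (hsym : ∀ z ∈ Metric.ball (0 : E) ρ, ∀ v w, fderiv ℝ a z v w = fderiv ℝ a z w v) :
    ∃ g : E → ℝ, ∀ z ∈ Metric.ball (0 : E) ρ, ContDiffAt ℝ r g z ∧ HasFDerivAt g (a z) z := by
  have hF : ∀ z ∈ Metric.ball (0 : E) ρ, ∀ t ∈ Icc (0 : ℝ) 1,
      ContDiffAt ℝ r (fun p : ℝ × E => a (p.1 • p.2) p.2) (t, z) := by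
    intro z hz t ht
    have h2 : ContDiffAt ℝ r (fun p : ℝ × E => p.1 • p.2) (t, z) := by fun_prop
    exact ((ha _ (smul_mem_ball_zero ht hz)).comp (t, z) h2).clm_apply contDiffAt_snd
  refine ⟨fun z => ∫ t in (0 : ℝ)..1, a (t • z) z, fun z hz =>
    ⟨contDiffAt_integral_zero_one hr (hF z hz), ?_⟩⟩
  have h1 : ∀ t ∈ Icc (0 : ℝ) 1,
      ContDiffAt ℝ 1 (fun p : ℝ × E => a (p.1 • p.2) p.2) (t, z) := fun t ht =>
    (hF z hz t ht).of_le (one_le_of_infty_or_omega hr)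
  have h2 := hasFDerivAt_integral_zero_one h1
  convert! h2 using 1
  have hda : ∀ t ∈ Icc (0 : ℝ) 1, HasFDerivAt a (fderiv ℝ a (t • z)) (t • z) := fun t ht =>
    ((ha _ (smul_mem_ball_zero ht hz)).differentiableAt
      (ne_zero_of_infty_or_omega hr)).hasFDerivAt
  have hint : ∀ t ∈ Icc (0 : ℝ) 1, ∀ v,
      (fderiv ℝ (fun p : ℝ × E => a (p.1 • p.2) p.2) (t, z)).comp
        (ContinuousLinearMap.inr ℝ ℝ E) v = t * fderiv ℝ a (t • z) z v + a (t • z) v := by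
    intro t ht v
    have hz2 : HasFDerivAt (fun z : E => a (t • z) z)
        ((fderiv ℝ (fun p : ℝ × E => a (p.1 • p.2) p.2) (t, z)).comp
          (ContinuousLinearMap.inr ℝ ℝ E)) z :=
      ((h1 t ht).differentiableAt (by simp)).hasFDerivAt.comp z (hasFDerivAt_prodMk_right t z)
    have hs : HasFDerivAt (fun z : E => t • z) (t • ContinuousLinearMap.id ℝ E) z :=
      (hasFDerivAt_id z).const_smul t
    have hz3 := ((hda t ht).comp z hs).clm_apply (hasFDerivAt_id z)
    rw [hz2.unique hz3]
    simp [hsym _ (smul_mem_ball_zero ht hz) z v, add_comm]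
  ext v
  have hcI : ContinuousOn (fun t : ℝ => (fderiv ℝ (fun p : ℝ × E => a (p.1 • p.2) p.2) (t, z)).comp
        (ContinuousLinearMap.inr ℝ ℝ E)) (uIcc 0 1) := by
    intro t ht
    rw [uIcc_of_le zero_le_one] at ht
    have h3 := ((h1 t ht).fderiv_right (m := 0) (by simp)).continuousAt
    have h4 := h3.comp (f := fun t : ℝ => (t, z)) (by fun_prop)
    exact (h4.clm_comp continuousAt_const).continuousWithinAt
  rw [ContinuousLinearMap.intervalIntegral_apply hcI.intervalIntegrable]
  -- By the symmetry of the derivative of `a`, the integrand is the `t`-derivative of `t a(t z) v`,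
  -- so the integral is `a(z) v`.
  have hd : ∀ t ∈ uIcc (0 : ℝ) 1, HasDerivAt (fun t : ℝ => t * a (t • z) v)
      ((fderiv ℝ (fun p : ℝ × E => a (p.1 • p.2) p.2) (t, z)).comp
        (ContinuousLinearMap.inr ℝ ℝ E) v) t := by
    intro t ht
    rw [uIcc_of_le zero_le_one] at ht
    rw [hint t ht v]
    have h3 : HasDerivAt (fun t : ℝ => t • z) ((1 : ℝ) • z) t := (hasDerivAt_id t).smul_const z
    have h4 := (hda t ht).comp_hasDerivAt t h3
    have h5 := (hasDerivAt_id t).mul (h4.clm_apply (hasDerivAt_const t v))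
    convert! h5 using 1
    simp [add_comm]
  have hint' : IntervalIntegrable (fun t : ℝ =>
      (fderiv ℝ (fun p : ℝ × E => a (p.1 • p.2) p.2) (t, z)).comp
        (ContinuousLinearMap.inr ℝ ℝ E) v) MeasureTheory.volume 0 1 :=
    (hcI.clm_apply continuousOn_const).intervalIntegrable
  rw [intervalIntegral.integral_eq_sub_of_hasDerivAt hd hint']
  simp

end Division

/-! ### First integrals of `H` and their differentials. -/

section FirstIntegrals

variable {r : WithTop ℕ∞} {s : ℝ} {k : ℕ}

/-- The differential of `ham`. -/
noncomputable def dham (s : ℝ) (k : ℕ) (z : ℝ × ℝ) : ℝ × ℝ →L[ℝ] ℝ :=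
  (s * (k * z.1 ^ (k - 1))) • ContinuousLinearMap.fst ℝ ℝ ℝ +
    (2 * z.2) • ContinuousLinearMap.snd ℝ ℝ ℝ

theorem hasFDerivAt_ham (s : ℝ) (k : ℕ) (z : ℝ × ℝ) : HasFDerivAt (ham s k) (dham s k z) z := by
  have h1 : HasFDerivAt (fun z : ℝ × ℝ => z.2 ^ 2)
      ((2 * z.2) • ContinuousLinearMap.snd ℝ ℝ ℝ) z := by
    simpa using (hasFDerivAt_snd (𝕜 := ℝ) (p := z)).pow 2
  have h2 := ((hasFDerivAt_fst (𝕜 := ℝ) (p := z)).pow k).const_mul s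
  have h3 := h1.add h2
  convert! h3 using 1
  ext <;> simp [dham]

theorem dham_apply (z v : ℝ × ℝ) :
    dham s k z v = s * (k * z.1 ^ (k - 1)) * v.1 + 2 * z.2 * v.2 := by
  simp [dham]

theorem contDiff_ham : ContDiff ℝ r (ham s k) := by
  unfold ham; fun_prop

theorem contDiff_dham : ContDiff ℝ r (dham s k) := by
  unfold dham
  fun_prop

/-- `g` is of class `C^r` and constant along the vector field `H_ξ ∂_x - H_x ∂_ξ` on `B`. -/
def IsFirstIntegralOn (r : WithTop ℕ∞) (s : ℝ) (k : ℕ) (g : ℝ × ℝ → ℝ) (B : Set (ℝ × ℝ)) : Prop :=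
  ∀ z ∈ B, ContDiffAt ℝ r g z ∧
    fderiv ℝ g z (1, 0) * (2 * z.2) = fderiv ℝ g z (0, 1) * (s * (k * z.1 ^ (k - 1)))

/-- The complement of the first axis is dense. This serves to cancel a factor equal to the second
coordinate. -/
theorem eq_of_eventually_snd_ne_zero_imp_eq {a b : ℝ × ℝ → ℝ} {z : ℝ × ℝ} (ha : ContinuousAt a z)
    (hb : ContinuousAt b z) (h : ∀ᶠ w in 𝓝 z, w.2 ≠ 0 → a w = b w) : a z = b z := by
  by_cases hz : z.2 = 0
  · have hl : Tendsto (fun t : ℝ => (z.1, t)) (𝓝[≠] 0) (𝓝 z) := by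
      have : Tendsto (fun t : ℝ => (z.1, t)) (𝓝 0) (𝓝 (z.1, 0)) :=
        Continuous.tendsto (by fun_prop) 0
      rw [← hz] at this ⊢
      exact this.mono_left nhdsWithin_le_nhds
    refine tendsto_nhds_unique_of_frequently_eq (ha.tendsto.comp hl) (hb.tendsto.comp hl) ?_
    refine Eventually.frequently ?_
    filter_upwards [hl.eventually h, self_mem_nhdsWithin] with t h1 h2 using h1 h2
  · exact h.self_of_nhds hz

theorem hasFDerivAt_dham (z : ℝ × ℝ) : HasFDerivAt (dham s k)
    (((s * (k * ((k - 1 : ℕ) * z.1 ^ (k - 1 - 1)))) • ContinuousLinearMap.fst ℝ ℝ ℝ).smulRight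
      (ContinuousLinearMap.fst ℝ ℝ ℝ) + ((2 : ℝ) • ContinuousLinearMap.snd ℝ ℝ ℝ).smulRight
      (ContinuousLinearMap.snd ℝ ℝ ℝ)) z := by
  have h1 : HasFDerivAt (fun z : ℝ × ℝ => s * (k * z.1 ^ (k - 1)))
      ((s * (k * ((k - 1 : ℕ) * z.1 ^ (k - 1 - 1)))) • ContinuousLinearMap.fst ℝ ℝ ℝ) z := by
    have := (((hasFDerivAt_fst (𝕜 := ℝ) (p := z)).pow (k - 1)).const_mul (k : ℝ)).const_mul s
    convert! this using 1
    ext <;> simp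
  have h2 : HasFDerivAt (fun z : ℝ × ℝ => 2 * z.2) ((2 : ℝ) • ContinuousLinearMap.snd ℝ ℝ ℝ) z :=
    (hasFDerivAt_snd (𝕜 := ℝ) (p := z)).const_mul 2
  exact (h1.smul_const (ContinuousLinearMap.fst ℝ ℝ ℝ)).add
    (h2.smul_const (ContinuousLinearMap.snd ℝ ℝ ℝ))

/-- The derivative of `l • dH` is symmetric exactly if `l` is a first integral of `H`. -/
theorem fderiv_smul_dham_apply {l : ℝ × ℝ → ℝ} {z : ℝ × ℝ} (hl : DifferentiableAt ℝ l z)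
    (v w : ℝ × ℝ) : fderiv ℝ (fun z => l z • dham s k z) z v w =
      l z * (s * (k * ((k - 1 : ℕ) * z.1 ^ (k - 1 - 1))) * v.1 * w.1 + 2 * v.2 * w.2) +
        fderiv ℝ l z v * dham s k z w := by
  have h : HasFDerivAt (fun z => l z • dham s k z) _ z :=
    hl.hasFDerivAt.smul (hasFDerivAt_dham z)
  rw [h.fderiv]
  simp [mul_add]

/-- In `g_x H_ξ = g_ξ H_x` the factor `H_ξ = 2ξ` forces `g_ξ = 0` on the first axis. Hadamard's
lemma divides `g_ξ` by `ξ`, and cancelling `ξ` gives `dg = l dH`. Then `d(dg) = 0` means `dl ∧ dH =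
0`, so that the step can be repeated with `l`. -/
theorem IsFirstIntegralOn.exists_hasFDerivAt (hr : r = ∞ ∨ r = ω) (hs : s ≠ 0) (hk : 2 < k)
    {g : ℝ × ℝ → ℝ} {ρ : ℝ} (hg : IsFirstIntegralOn r s k g (Metric.ball 0 ρ)) :
    ∃ l, IsFirstIntegralOn r s k l (Metric.ball 0 ρ) ∧
      ∀ z ∈ Metric.ball (0 : ℝ × ℝ) ρ, HasFDerivAt g (l z • dham s k z) z := by
  have hr1 := add_one_le_of_infty_or_omega hr
  have hr0 := ne_zero_of_infty_or_omega hr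
  have hk0 : (k : ℝ) ≠ 0 := by positivity
  have hder : ∀ v, ∀ z ∈ Metric.ball (0 : ℝ × ℝ) ρ, ContDiffAt ℝ r (fun z => fderiv ℝ g z v) z :=
    fun v z hz => ((hg z hz).1.fderiv_right hr1).clm_apply contDiffAt_const
  have hax : ∀ x, (x, (0 : ℝ)) ∈ Metric.ball (0 : ℝ × ℝ) ρ → fderiv ℝ g (x, 0) (0, 1) = 0 := by
    have hne : ∀ x, x ≠ 0 → (x, (0 : ℝ)) ∈ Metric.ball (0 : ℝ × ℝ) ρ →
        fderiv ℝ g (x, 0) (0, 1) = 0 := by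
      intro x hx hm
      have := (hg _ hm).2
      have hx' : s * (k * x ^ (k - 1)) ≠ 0 := mul_ne_zero hs (mul_ne_zero hk0 (pow_ne_zero _ hx))
      simpa [hs, hk0, hx] using this
    intro x hm
    -- At the origin `H_x` vanishes as well; the value there follows by continuity.
    by_cases hx : x = 0
    · subst hx
      have hl : Tendsto (fun t : ℝ => (t, (0 : ℝ))) (𝓝[≠] 0) (𝓝 (0, 0)) :=
        (Continuous.tendsto (by fun_prop) 0).mono_left nhdsWithin_le_nhds
      refine tendsto_nhds_unique_of_frequently_eq ((hder (0, 1) _ hm).continuousAt.tendsto.comp hl)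
        tendsto_const_nhds (Eventually.frequently ?_)
      filter_upwards [hl.eventually (Metric.isOpen_ball.mem_nhds hm), self_mem_nhdsWithin]
        with t h1 h2 using hne t h2 h1
    · exact hne x hx hm
  obtain ⟨l, hl, hgl⟩ := exists_eq_snd_mul hr (hder (0, 1)) hax
  have hfd : ∀ z ∈ Metric.ball (0 : ℝ × ℝ) ρ,
      HasFDerivAt g ((2⁻¹ * l z) • dham s k z) z := by
    intro z hz
    have h1 : fderiv ℝ g z (1, 0) = 2⁻¹ * l z * (s * (k * z.1 ^ (k - 1))) := by
      refine eq_of_eventually_snd_ne_zero_imp_eq (a := fun z => fderiv ℝ g z (1, 0))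
        (b := fun z => 2⁻¹ * l z * (s * (k * z.1 ^ (k - 1))))
        (hder _ z hz).continuousAt ?_ ?_
      · have := (hl z hz).continuousAt
        fun_prop
      · filter_upwards [Metric.isOpen_ball.mem_nhds hz] with w hw hw0
        have h2 := (hg w hw).2
        rw [hgl w hw] at h2
        have : (fderiv ℝ g w (1, 0) - 2⁻¹ * l w * (s * (k * w.1 ^ (k - 1)))) * (2 * w.2) = 0 := by
          linear_combination h2
        have h3 := (mul_eq_zero.1 this).resolve_right (by simpa using hw0)
        linarith
    have h2 := ((hg z hz).1.differentiableAt hr0).hasFDerivAt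
    convert! h2 using 1
    ext
    · simp [dham_apply, h1]
    · simp [dham_apply, hgl z hz]; ring
  refine ⟨fun z => 2⁻¹ * l z, fun z hz => ⟨contDiffAt_const.mul (hl z hz), ?_⟩, hfd⟩
  have hld : DifferentiableAt ℝ (fun z => 2⁻¹ * l z) z :=
    (contDiffAt_const.mul (hl z hz)).differentiableAt hr0
  have hsym := second_derivative_symmetric_of_eventually (f := g)
    (f' := fun z => (2⁻¹ * l z) • dham s k z)
    (eventually_of_mem (Metric.isOpen_ball.mem_nhds hz) hfd)
    (hld.smul (hasFDerivAt_dham z).differentiableAt).hasFDerivAt (1, 0) (0, 1)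
  have e1 := fderiv_smul_dham_apply (s := s) (k := k) hld (1, 0) (0, 1)
  have e2 := fderiv_smul_dham_apply (s := s) (k := k) hld (0, 1) (1, 0)
  have e3 := e1.symm.trans (hsym.trans e2)
  simpa [dham_apply] using e3

/-- The form `τ dH` is closed because `dτ ∧ dH = 0`. -/
theorem IsFirstIntegralOn.exists_primitive (hr : r = ∞ ∨ r = ω)
    {τ : ℝ × ℝ → ℝ} {ρ : ℝ} (hτ : IsFirstIntegralOn r s k τ (Metric.ball 0 ρ)) :
    ∃ g : ℝ × ℝ → ℝ, ∀ z ∈ Metric.ball (0 : ℝ × ℝ) ρ,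
      ContDiffAt ℝ r g z ∧ HasFDerivAt g (τ z • dham s k z) z := by
  refine AkSingularity.exists_primitive hr (a := fun z => τ z • dham s k z)
    (fun z hz => (hτ z hz).1.smul contDiff_dham.contDiffAt) fun z hz v w => ?_
  have hd := (hτ z hz).1.differentiableAt (ne_zero_of_infty_or_omega hr)
  rw [fderiv_smul_dham_apply hd, fderiv_smul_dham_apply hd]
  have hv : ∀ v : ℝ × ℝ,
      fderiv ℝ τ z v = v.1 * fderiv ℝ τ z (1, 0) + v.2 * fderiv ℝ τ z (0, 1) := by
    intro v
    conv_lhs => rw [show v = v.1 • ((1 : ℝ), (0 : ℝ)) + v.2 • ((0 : ℝ), (1 : ℝ)) by ext <;> simp]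
    rw [map_add, map_smul, map_smul, smul_eq_mul, smul_eq_mul]
  rw [hv v, hv w, dham_apply, dham_apply]
  linear_combination (v.1 * w.2 - v.2 * w.1) * (hτ z hz).2

end FirstIntegrals

/-! ### Constancy on connected subsets of level sets. -/

section LevelSets

variable {r : WithTop ℕ∞} {s : ℝ} {k : ℕ}

/-- By Fubini, as each vertical line meets the level set in at most two points. -/
theorem volume_ham_level (s : ℝ) (k : ℕ) (h : ℝ) :
    MeasureTheory.volume (ham s k ⁻¹' {h}) = 0 := by
  have hm : MeasurableSet (ham s k ⁻¹' {h}) :=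
    (isClosed_singleton.preimage (contDiff_ham (r := 0)).continuous).measurableSet
  rw [MeasureTheory.Measure.volume_eq_prod, MeasureTheory.Measure.measure_prod_null hm]
  refine Eventually.of_forall fun x => ?_
  refine Set.Finite.measure_zero (Set.Finite.subset
    (s := {√(h - s * x ^ k), -√(h - s * x ^ k)}) (by simp) fun ξ hξ => ?_) _
  have h1 : ξ ^ 2 = h - s * x ^ k := by
    simp only [mem_preimage, mem_singleton_iff, ham] at hξ
    linarith
  rw [← h1, Real.sqrt_sq_eq_abs]
  rcases abs_choice ξ with h2 | h2 <;> simp [h2]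

/-- A function whose differential is proportional to `dH` is constant on the connected subsets of
the level sets of `H`: it is Hölder of exponent `2` there, so that it maps a level set to a null
set. -/
theorem exists_forall_isPreconnected_eq {g l : ℝ × ℝ → ℝ} {ρ : ℝ} (hρ : 0 < ρ)
    (hl : ContDiffAt ℝ 1 l 0)
    (hg : ∀ z ∈ Metric.ball (0 : ℝ × ℝ) ρ, HasFDerivAt g (l z • dham s k z) z) :
    ∃ ρ' > 0, ρ' ≤ ρ ∧ ∀ S ⊆ Metric.ball (0 : ℝ × ℝ) ρ', IsPreconnected S →
      ∀ h, (∀ p ∈ S, ham s k p = h) → ∀ p ∈ S, ∀ q ∈ S, g p = g q := by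
  obtain ⟨K, t, ht, hK⟩ := hl.exists_lipschitzOnWith
  obtain ⟨M, hM⟩ : ∃ M : ℝ, ∀ᶠ z in 𝓝 (0 : ℝ × ℝ), ‖dham s k z‖ ≤ M := by
    have hc : ContinuousAt (fun z => ‖dham s k z‖) (0 : ℝ × ℝ) :=
      (contDiff_dham (r := 0)).continuous.continuousAt.norm
    exact ⟨‖dham s k 0‖ + 1, (hc.eventually (gt_mem_nhds (lt_add_one _))).mono fun _ h => h.le⟩
  obtain ⟨ε, hε, hball⟩ := Metric.mem_nhds_iff.1 (inter_mem ht hM)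
  refine ⟨min ε ρ, lt_min hε hρ, min_le_right _ _, fun S hS hconn h hh p hp q hq => ?_⟩
  have hconv := convex_ball (0 : ℝ × ℝ) (min ε ρ)
  have hM0 : 0 ≤ M := (norm_nonneg _).trans (hball (Metric.mem_ball_self hε)).2
  have est : ∀ p ∈ S, ∀ q ∈ S, ‖g q - g p‖ ≤ K * M * ‖q - p‖ ^ 2 := by
    intro p hp q hq
    have hseg : segment ℝ p q ⊆ Metric.ball 0 (min ε ρ) := hconv.segment_subset (hS hp) (hS hq)
    -- The segment leaves the level set, so `l(p) H` is subtracted: its values at `p` and `q` agree,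
    -- and the remaining differential `(l(z) - l(p)) dH` is of order `‖q - p‖` since `l` is
    -- Lipschitz.
    have hd : ∀ z ∈ segment ℝ p q, HasFDerivWithinAt (fun z => g z - l p * ham s k z)
        (l z • dham s k z - l p • dham s k z) (segment ℝ p q) z := fun z hz =>
      ((hg z (Metric.ball_subset_ball (min_le_right _ _) (hseg hz))).sub
        ((hasFDerivAt_ham s k z).const_mul (l p))).hasFDerivWithinAt
    have hb : ∀ z ∈ segment ℝ p q,
        ‖l z • dham s k z - l p • dham s k z‖ ≤ K * ‖q - p‖ * M := by
      intro z hz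
      have hz' := hball (Metric.ball_subset_ball (min_le_left _ _) (hseg hz))
      have hp' := hball (Metric.ball_subset_ball (min_le_left _ _) (hS hp))
      rw [show l z • dham s k z - l p • dham s k z = (l z - l p) • dham s k z from
        (sub_smul _ _ _).symm, norm_smul]
      have h1 : ‖l z - l p‖ ≤ K * ‖z - p‖ := by
        simpa [dist_eq_norm] using hK.dist_le_mul z hz'.1 p hp'.1
      have h2 : ‖z - p‖ ≤ ‖q - p‖ := by
        obtain ⟨θ, hθ, rfl⟩ := (segment_eq_image' ℝ p q ▸ hz :)
        simp only [add_sub_cancel_left, norm_smul, Real.norm_of_nonneg hθ.1]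
        exact mul_le_of_le_one_left (norm_nonneg _) hθ.2
      calc _ ≤ K * ‖z - p‖ * M := by
            gcongr
            exact hz'.2
        _ ≤ _ := by gcongr
    have := (convex_segment p q).norm_image_sub_le_of_norm_hasFDerivWithin_le hd hb
      (left_mem_segment ℝ p q) (right_mem_segment ℝ p q)
    simp only [hh p hp, hh q hq] at this
    calc _ = ‖g q - l p * h - (g p - l p * h)‖ := by congr 1; ring
      _ ≤ _ := this
      _ = _ := by ring
  have hhol : HolderOnWith (K * M.toNNReal) 2 g S := by
    intro p hp q hq
    have h1 := est q hq p hp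
    rw [edist_dist, edist_dist, dist_eq_norm, dist_eq_norm]
    have h2 : ((K * M.toNNReal : NNReal) : ENNReal) = ENNReal.ofReal (K * M) := by
      rw [ENNReal.ofReal, Real.toNNReal_mul K.coe_nonneg, Real.toNNReal_coe]
    rw [h2, NNReal.coe_ofNat, ENNReal.rpow_ofNat, ← ENNReal.ofReal_pow (norm_nonneg _),
      ← ENNReal.ofReal_mul (by positivity)]
    exact ENNReal.ofReal_le_ofReal h1
  -- Exponent `2` bounds the one-dimensional measure of the image by the two-dimensional measure of
  -- `S`, which is its area and vanishes. An interval of measure zero is a point.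
  have hnull : MeasureTheory.volume (g '' S) = 0 := by
    have h1 := hhol.hausdorffMeasure_image_le (by norm_num) (d := 1) zero_le_one
    have h2 : MeasureTheory.Measure.hausdorffMeasure (2 : ℝ) S = 0 := by
      rw [MeasureTheory.hausdorffMeasure_prod_real]
      exact MeasureTheory.measure_mono_null (fun p hp => hh p hp) (volume_ham_level s k h)
    rw [MeasureTheory.hausdorffMeasure_real, NNReal.coe_ofNat, mul_one, h2, mul_zero] at h1
    exact le_antisymm h1 zero_le
  have hgc : ContinuousOn g S := fun z hz =>
    (hg z (Metric.ball_subset_ball (min_le_right _ _) (hS hz))).continuousAt.continuousWithinAt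
  have hpre := (hconn.image g hgc).ordConnected
  by_contra hne
  have hI : uIcc (g p) (g q) ⊆ g '' S :=
    hpre.uIcc_subset (mem_image_of_mem g hp) (mem_image_of_mem g hq)
  have h3 := MeasureTheory.measure_mono_null hI hnull
  rw [uIcc, Real.volume_Icc, ENNReal.ofReal_eq_zero, max_sub_min_eq_abs] at h3
  exact hne (sub_eq_zero.1 (abs_nonpos_iff.1 h3)).symm

end LevelSets

/-! ### Odd `k`: first integrals as functions of `H`. -/

section OddCase

variable {r : WithTop ℕ∞} {s : ℝ} {k : ℕ}

/-- The inverse of an odd power. -/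
theorem exists_continuous_root (hk : Odd k) :
    ∃ R : ℝ → ℝ, Continuous R ∧ (∀ x, R x ^ k = x) ∧ R 0 = 0 := by
  have hk0 : k ≠ 0 := hk.pos.ne'
  have hsurj : Function.Surjective fun x : ℝ => x ^ k :=
    Continuous.surjective (by fun_prop) (tendsto_pow_atTop hk0)
      ((tendsto_neg_atTop_atBot.comp
        ((tendsto_pow_atTop hk0).comp tendsto_neg_atBot_atTop)).congr fun x => by
          simp [hk.neg_pow])
  let e := hk.strictMono_pow.orderIsoOfSurjective (fun x : ℝ => x ^ k) hsurj
  have he : ∀ x, e.symm x ^ k = x := fun x => e.apply_symm_apply x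
  refine ⟨e.symm, e.symm.continuous, he, ?_⟩
  exact pow_eq_zero_iff hk0 |>.1 (he 0)

/-- An even analytic function is an analytic function of the square. -/
theorem exists_analyticAt_comp_sq {e : ℝ → ℝ} (he : AnalyticAt ℝ e 0)
    (heven : ∀ᶠ x in 𝓝 0, e (-x) = e x) :
    ∃ G : ℝ → ℝ, AnalyticAt ℝ G 0 ∧ ∀ᶠ x in 𝓝 0, e x = G (x ^ 2) := by
  obtain ⟨p, R, hp⟩ := he
  obtain ⟨ρ, hρ0, hρR⟩ := ENNReal.lt_iff_exists_nnreal_btwn.1 hp.r_pos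
  have hρ0 : 0 < ρ := by exact_mod_cast hρ0
  set c : ℕ → ℝ := fun n => p.coeff (2 * n) with hc
  have hsum : Summable fun n => ‖c n‖ * (ρ ^ 2) ^ n := by
    have h1 := p.summable_norm_mul_pow (hρR.trans_le hp.r_le)
    have h2 := h1.comp_injective (i := fun n => 2 * n) (mul_right_injective₀ two_ne_zero)
    refine h2.congr fun n => ?_
    simp only [Function.comp, hc, ← pow_mul, FormalMultilinearSeries.norm_apply_eq_norm_coef]
  have hrad : ((ρ ^ 2 : NNReal) : ENNReal) ≤
      (FormalMultilinearSeries.ofScalars ℝ c).radius := by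
    refine FormalMultilinearSeries.le_radius_of_summable_norm _ ?_
    refine hsum.congr fun n => ?_
    rw [FormalMultilinearSeries.ofScalars_norm]
    push_cast
    rfl
  have hpos : 0 < (FormalMultilinearSeries.ofScalars ℝ c).radius :=
    lt_of_lt_of_le (by exact_mod_cast pow_pos hρ0 2) hrad
  have hG := (FormalMultilinearSeries.ofScalars ℝ c).hasFPowerSeriesOnBall hpos
  refine ⟨_, hG.analyticAt, ?_⟩
  filter_upwards [heven, Metric.ball_mem_nhds (0 : ℝ) (NNReal.coe_pos.2 hρ0)] with x hx hxρ
  have hxρ' : |x| < ρ := by simpa using hxρ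
  have hmem : ∀ y : ℝ, |y| < ρ → HasSum (fun n => y ^ n * p.coeff n) (e y) := by
    intro y hy
    have : y ∈ Metric.eball (0 : ℝ) R := by
      rw [mem_eball_zero_iff]
      refine lt_trans ?_ hρR
      rw [enorm_eq_nnnorm, ENNReal.coe_lt_coe, ← NNReal.coe_lt_coe]
      simpa using hy
    have h1 := hp.hasSum this
    rw [zero_add] at h1
    convert! h1 using 2 with n
    simp
  have h1 := hmem x hxρ'
  have h2 := hmem (-x) (by simpa using hxρ')
  rw [hx] at h2
  -- Averaging the expansions at `x` and `-x` removes the odd coefficients.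
  have h3 := (h1.add h2).mul_left (2⁻¹)
  have h4 : HasSum (fun n => (x ^ 2) ^ n * c n) (e x) := by
    have h5 : 2⁻¹ * (e x + e x) = e x := by ring
    rw [h5] at h3
    have h6 := (Function.Injective.hasSum_iff (g := fun n : ℕ => 2 * n)
      (mul_right_injective₀ two_ne_zero) (a := e x)
      (f := fun n => 2⁻¹ * (x ^ n * p.coeff n + (-x) ^ n * p.coeff n)) ?_).2 h3
    · convert! h6 using 2 with n
      simp only [Function.comp, hc, pow_mul, neg_sq]
      ring
    · intro n hn
      have : Odd n := by
        rw [← Nat.not_even_iff_odd]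
        rintro ⟨m, rfl⟩
        exact hn ⟨m, by ring⟩
      rw [this.neg_pow]
      ring
  have hx2 : x ^ 2 ∈ Metric.eball (0 : ℝ) (FormalMultilinearSeries.ofScalars ℝ c).radius := by
    rw [mem_eball_zero_iff]
    refine lt_of_lt_of_le ?_ hrad
    rw [enorm_eq_nnnorm, ENNReal.coe_lt_coe, ← NNReal.coe_lt_coe]
    push_cast
    rw [norm_pow, Real.norm_eq_abs]
    gcongr
  have h7 := hG.hasSum hx2
  rw [zero_add] at h7
  refine h4.unique ?_
  convert! h7 using 2 with n
  simp [mul_comm]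

/-- With `eq_root_of_ham_eq`, each level set is a graph over the second axis when `k` is odd. -/
theorem ham_root {R : ℝ → ℝ} (hs : s = 1 ∨ s = -1) (hR : ∀ x, R x ^ k = x) (h ξ : ℝ) :
    ham s k (R (s * (h - ξ ^ 2)), ξ) = h := by
  simp only [ham, hR]
  rcases hs with rfl | rfl <;> ring

theorem eq_root_of_ham_eq {R : ℝ → ℝ} (hs : s = 1 ∨ s = -1) (hk : Odd k) (hR : ∀ x, R x ^ k = x)
    {z : ℝ × ℝ} {h : ℝ} (hz : ham s k z = h) : z.1 = R (s * (h - z.2 ^ 2)) := by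
  refine hk.strictMono_pow.injective ?_
  simp only [hR, ← hz, ham]
  rcases hs with rfl | rfl <;> ring

/-- For odd `k` a function that is constant on the connected subsets of the level sets of `H` is,
on a small neighbourhood, constant on the whole level sets. -/
theorem exists_forall_ham_eq_imp_eq (hs : s = 1 ∨ s = -1) (hk : Odd k) {g : ℝ × ℝ → ℝ} {ρ : ℝ}
    (hρ : 0 < ρ) (hg : ∀ S ⊆ Metric.ball (0 : ℝ × ℝ) ρ, IsPreconnected S →
      ∀ h, (∀ p ∈ S, ham s k p = h) → ∀ p ∈ S, ∀ q ∈ S, g p = g q) :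
    ∃ V : Set (ℝ × ℝ), IsOpen V ∧ 0 ∈ V ∧ V ⊆ Metric.ball 0 ρ ∧
      ∀ p ∈ V, ∀ q ∈ V, ham s k p = ham s k q → g p = g q := by
  obtain ⟨R, hRc, hR, -⟩ := exists_continuous_root hk
  have hk0 : k ≠ 0 := hk.pos.ne'
  -- Where `|ξ| < δ` and `|H| < δ²`, one has `|x|^k ≤ |H| + ξ² < 2 δ² < ρ^k`; this keeps whole arcs
  -- of level sets in the ball.
  obtain ⟨δ, hδ0, hδρ, hδk⟩ : ∃ δ > 0, δ ≤ ρ ∧ 2 * δ ^ 2 < ρ ^ k := by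
    have h1 : Tendsto (fun δ : ℝ => 2 * δ ^ 2) (𝓝[>] 0) (𝓝 (2 * 0 ^ 2)) :=
      (Continuous.tendsto (by fun_prop) 0).mono_left nhdsWithin_le_nhds
    have h2 : (2 : ℝ) * 0 ^ 2 < ρ ^ k := by simpa using pow_pos hρ k
    obtain ⟨δ, h3, h4, h5⟩ := ((h1.eventually (gt_mem_nhds h2)).and
      ((Ioc_mem_nhdsGT hρ))).exists
    exact ⟨δ, h4, h5, h3⟩
  have hcont := (contDiff_ham (s := s) (k := k) (r := 0)).continuous
  refine ⟨{z | |z.2| < δ ∧ |ham s k z| < δ ^ 2}, ?_, ?_, ?_, ?_⟩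
  · exact (isOpen_lt continuous_snd.abs continuous_const).inter
      (isOpen_lt hcont.abs continuous_const)
  · simp [ham, hk0, hδ0]
  · rintro z ⟨h1, h2⟩
    rw [mem_ball_zero_iff, Prod.norm_def, max_lt_iff]
    refine ⟨?_, h1.trans_le hδρ⟩
    refine lt_of_pow_lt_pow_left₀ k hρ.le (lt_of_le_of_lt ?_ hδk)
    have h3 : |z.1| ^ k = |ham s k z - z.2 ^ 2| := by
      rw [← abs_pow]
      rcases hs with rfl | rfl <;> simp [ham]
    have h4 : |z.2| ^ 2 < δ ^ 2 := by gcongr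
    rw [sq_abs] at h4
    rw [Real.norm_eq_abs, h3]
    refine (abs_sub _ _).trans ?_
    rw [abs_of_nonneg (sq_nonneg z.2)]
    linarith
  · rintro p ⟨hp1, hp2⟩ q ⟨hq1, hq2⟩ hpq
    set c : ℝ → ℝ × ℝ := fun ξ => (R (s * (ham s k p - ξ ^ 2)), ξ) with hc
    have hsub : c '' Ioo (-δ) δ ⊆ Metric.ball 0 ρ := by
      rintro _ ⟨ξ, hξ, rfl⟩
      have h1 : |ξ| < δ := abs_lt.2 hξ
      rw [mem_ball_zero_iff, Prod.norm_def, max_lt_iff]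
      refine ⟨?_, h1.trans_le hδρ⟩
      refine lt_of_pow_lt_pow_left₀ k hρ.le (lt_of_le_of_lt ?_ hδk)
      have h4 : |ξ| ^ 2 < δ ^ 2 := by gcongr
      rw [sq_abs] at h4
      have hs1 : |s| = 1 := by rcases hs with rfl | rfl <;> simp
      rw [Real.norm_eq_abs, ← abs_pow, hR, abs_mul, hs1, one_mul]
      refine (abs_sub _ _).trans ?_
      rw [abs_of_nonneg (sq_nonneg ξ)]
      linarith
    have hpc : IsPreconnected (c '' Ioo (-δ) δ) :=
      isPreconnected_Ioo.image c (by fun_prop : Continuous c).continuousOn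
    refine hg _ hsub hpc (ham s k p) ?_ p ⟨p.2, abs_lt.1 hp1, ?_⟩ q ⟨q.2, abs_lt.1 hq1, ?_⟩
    · rintro _ ⟨ξ, -, rfl⟩
      exact ham_root hs hR _ _
    · exact Prod.ext (eq_root_of_ham_eq hs hk hR rfl).symm rfl
    · exact Prod.ext (eq_root_of_ham_eq hs hk hR hpq.symm).symm rfl

/-- If `f` has the derivative `g` near a point, except possibly at that point, and both functions
are continuous there, then `f` has the derivative `g` at that point, too. -/
theorem hasDerivAt_of_eventually_hasDerivAt_of_ne {f g : ℝ → ℝ} {x : ℝ}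
    (hd : ∀ᶠ y in 𝓝 x, y ≠ x → HasDerivAt f (g y) y) (hf : ContinuousAt f x)
    (hg : ContinuousAt g x) : HasDerivAt f (g x) x := by
  have hset : {y | y ≠ x → HasDerivAt f (g y) y} ∈ 𝓝 x := hd
  have A : HasDerivWithinAt f (g x) (Ici x) x := by
    refine hasDerivWithinAt_Ici_of_tendsto_deriv
      (s := Ioi x ∩ {y | y ≠ x → HasDerivAt f (g y) y})
      (fun y hy => (hy.2 (ne_of_gt hy.1)).differentiableAt.differentiableWithinAt)
      hf.continuousWithinAt (inter_mem self_mem_nhdsWithin (mem_nhdsWithin_of_mem_nhds hset)) ?_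
    refine (hg.tendsto.mono_left nhdsWithin_le_nhds).congr' ?_
    filter_upwards [self_mem_nhdsWithin, mem_nhdsWithin_of_mem_nhds hset] with y h1 h2
      using (h2 (ne_of_gt h1)).deriv.symm
  have B : HasDerivWithinAt f (g x) (Iic x) x := by
    refine hasDerivWithinAt_Iic_of_tendsto_deriv
      (s := Iio x ∩ {y | y ≠ x → HasDerivAt f (g y) y})
      (fun y hy => (hy.2 (ne_of_lt hy.1)).differentiableAt.differentiableWithinAt)
      hf.continuousWithinAt (inter_mem self_mem_nhdsWithin (mem_nhdsWithin_of_mem_nhds hset)) ?_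
    refine (hg.tendsto.mono_left nhdsWithin_le_nhds).congr' ?_
    filter_upwards [self_mem_nhdsWithin, mem_nhdsWithin_of_mem_nhds hset] with y h1 h2
      using (h2 (ne_of_lt h1)).deriv.symm
  simpa using B.union A

theorem hasDerivAt_root {R : ℝ → ℝ} (hRc : Continuous R) (hR : ∀ x, R x ^ k = x) (hk0 : k ≠ 0)
    {x : ℝ} (hx : x ≠ 0) : HasDerivAt R (k * R x ^ (k - 1))⁻¹ x := by
  have h1 : HasDerivAt (fun y : ℝ => y ^ k) (k * R x ^ (k - 1)) (R x) := hasDerivAt_pow k (R x)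
  have hRx : R x ≠ 0 := by
    intro h
    have := hR x
    rw [h, zero_pow hk0] at this
    exact hx this.symm
  have h2 : (k * R x ^ (k - 1) : ℝ) ≠ 0 := mul_ne_zero (by exact_mod_cast hk0) (pow_ne_zero _ hRx)
  exact h1.of_local_left_inverse hRc.continuousAt h2 (Eventually.of_forall hR)

/-- For odd `k` a smooth first integral of `H` is a smooth function of `H` along the first axis. -/
theorem IsFirstIntegralOn.contDiffOn_root (hs : s = 1 ∨ s = -1) (hk : Odd k) (hk2 : 2 < k)
    {R : ℝ → ℝ} (hRc : Continuous R) (hR : ∀ x, R x ^ k = x) {ρ : ℝ} (n : ℕ) :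
    ∀ {g : ℝ × ℝ → ℝ}, IsFirstIntegralOn ∞ s k g (Metric.ball 0 ρ) →
      ContDiffOn ℝ n (fun h => g (R (s * h), 0)) {h | (R (s * h), (0 : ℝ)) ∈ Metric.ball 0 ρ} := by
  have hk0 : k ≠ 0 := hk.pos.ne'
  have hs0 : s ≠ 0 := by rcases hs with rfl | rfl <;> norm_num
  have hcc : Continuous fun h : ℝ => (R (s * h), (0 : ℝ)) := by fun_prop
  have hopen : IsOpen {h | (R (s * h), (0 : ℝ)) ∈ Metric.ball 0 ρ} :=
    Metric.isOpen_ball.preimage hcc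
  induction n with
  | zero =>
    intro g hg
    refine contDiffOn_zero.2 fun h hh => ?_
    exact ((hg _ hh).1.continuousAt.comp (f := fun h : ℝ => (R (s * h), (0 : ℝ)))
      hcc.continuousAt).continuousWithinAt
  | succ n ih =>
    intro g hg
    obtain ⟨l, hl, hgl⟩ := hg.exists_hasFDerivAt (Or.inl rfl) hs0 hk2
    have hcont : ∀ {g : ℝ × ℝ → ℝ}, IsFirstIntegralOn ∞ s k g (Metric.ball 0 ρ) →
        ∀ h ∈ {h | (R (s * h), (0 : ℝ)) ∈ Metric.ball 0 ρ},
          ContinuousAt (fun h => g (R (s * h), 0)) h := fun hg h hh =>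
      (hg _ hh).1.continuousAt.comp (f := fun h : ℝ => (R (s * h), (0 : ℝ))) hcc.continuousAt
    -- The derivative of `R` blows up at `0`, but its factor `1 / (k R^(k-1))` cancels against `H_x`
    -- in `dg = l dH`. What remains is the expression for `l` in place of `g`, which extends
    -- continuously over `h = 0`.
    have hne : ∀ h ∈ {h | (R (s * h), (0 : ℝ)) ∈ Metric.ball 0 ρ}, h ≠ 0 →
        HasDerivAt (fun h => g (R (s * h), 0)) (l (R (s * h), 0)) h := by
      intro h hh h0
      have h1 : HasDerivAt (fun h => R (s * h)) ((k * R (s * h) ^ (k - 1))⁻¹ * (s * 1)) h :=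
        (hasDerivAt_root hRc hR hk0 (mul_ne_zero hs0 h0)).comp h ((hasDerivAt_id h).const_mul s)
      have h2 := (hgl _ hh).comp_hasDerivAt h (h1.prodMk (hasDerivAt_const h (0 : ℝ)))
      have hRx : R (s * h) ≠ 0 := by
        intro h3
        have := hR (s * h)
        rw [h3, zero_pow hk0] at this
        exact mul_ne_zero hs0 h0 this.symm
      have hk' : (k : ℝ) ≠ 0 := by exact_mod_cast hk0
      convert! h2 using 1
      have hs2 : s * s = 1 := by rcases hs with rfl | rfl <;> norm_num
      simp only [smul_apply, dham_apply, smul_eq_mul]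
      field_simp
      linear_combination (- l (R (s * h), 0)) * hs2
    have hall : ∀ h ∈ {h | (R (s * h), (0 : ℝ)) ∈ Metric.ball 0 ρ},
        HasDerivAt (fun h => g (R (s * h), 0)) (l (R (s * h), 0)) h := by
      intro h hh
      by_cases h0 : h = 0
      · subst h0
        have hev := hopen.mem_nhds hh
        exact hasDerivAt_of_eventually_hasDerivAt_of_ne (g := fun h => l (R (s * h), 0))
          (eventually_of_mem hev hne) (hcont hg 0 hh) (hcont hl 0 hh)
      · exact hne h hh h0
    push_cast
    refine (contDiffOn_succ_iff_deriv_of_isOpen hopen).2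
      ⟨fun h hh => (hall h hh).differentiableAt.differentiableWithinAt, by simp, ?_⟩
    exact (ih hl).congr fun h hh => (hall h hh).deriv

/-- For odd `k` a first integral of `H` is a function of `H` of the same class. -/
theorem IsFirstIntegralOn.exists_comp_ham (hr : r = ∞ ∨ r = ω) (hs : s = 1 ∨ s = -1) (hk : Odd k)
    (hk2 : 2 < k) {g : ℝ × ℝ → ℝ} {ρ : ℝ} (hρ : 0 < ρ)
    (hg : IsFirstIntegralOn r s k g (Metric.ball 0 ρ)) :
    ∃ (V : Set (ℝ × ℝ)) (J : Set ℝ) (G : ℝ → ℝ), IsOpen V ∧ 0 ∈ V ∧ V ⊆ Metric.ball 0 ρ ∧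
      IsOpen J ∧ MapsTo (ham s k) V J ∧ ContDiffOn ℝ r G J ∧ ∀ z ∈ V, g z = G (ham s k z) := by
  have hk0 : k ≠ 0 := hk.pos.ne'
  have hs0 : s ≠ 0 := by rcases hs with rfl | rfl <;> norm_num
  have hH0 : ham s k 0 = 0 := by simp [ham, hk0]
  have hHc := (contDiff_ham (s := s) (k := k) (r := 0)).continuous
  obtain ⟨l, hl, hgl⟩ := hg.exists_hasFDerivAt hr hs0 hk2
  obtain ⟨ρ', hρ', hρρ, hconst⟩ := exists_forall_isPreconnected_eq hρ
    ((hl 0 (Metric.mem_ball_self hρ)).1.of_le (one_le_of_infty_or_omega hr)) hgl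
  obtain ⟨V, hV, hV0, hVρ, hVc⟩ := exists_forall_ham_eq_imp_eq hs hk hρ' hconst
  obtain ⟨R, hRc, hR, hR0⟩ := exists_continuous_root hk
  rcases hr with rfl | rfl
  · have hcc : Continuous fun h : ℝ => (R (s * h), (0 : ℝ)) := by fun_prop
    have hcV : IsOpen {h : ℝ | (R (s * h), (0 : ℝ)) ∈ V} := hV.preimage hcc
    refine ⟨V ∩ ham s k ⁻¹' {h : ℝ | (R (s * h), (0 : ℝ)) ∈ V}, {h | (R (s * h), (0 : ℝ)) ∈ V},
      fun h => g (R (s * h), 0), hV.inter (hcV.preimage hHc), ⟨hV0, ?_⟩,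
      inter_subset_left.trans (hVρ.trans (Metric.ball_subset_ball hρρ)), hcV,
      fun z hz => hz.2, ?_, fun z hz => ?_⟩
    · simpa [hH0, hR0, Prod.mk_zero_zero] using hV0
    · refine contDiffOn_infty.2 fun n => ?_
      exact (hg.contDiffOn_root hs hk hk2 hRc hR n).mono fun h hh =>
        Metric.ball_subset_ball hρρ (hVρ hh)
    · refine hVc _ hz.1 _ hz.2 ?_
      have := ham_root (k := k) hs hR (ham s k z) 0
      simpa using this.symm
  · have hax : Continuous fun ξ : ℝ => ((0 : ℝ), ξ) := by fun_prop
    have hax' : Tendsto (fun ξ : ℝ => ((0 : ℝ), ξ)) (𝓝 0) (𝓝 0) := hax.tendsto 0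
    have hga := (hg 0 (Metric.mem_ball_self hρ)).1.analyticAt
    have hHaxis : ∀ ξ : ℝ, ham s k (0, ξ) = ξ ^ 2 := fun ξ => by simp [ham, hk0]
    -- The root is not analytic at `0`, so the second axis is used instead: there `H = ξ²`, and `g`
    -- is even because `(0, ξ)` and `(0, -ξ)` lie on the same level.
    obtain ⟨G, hG, hGe⟩ := exists_analyticAt_comp_sq (e := fun ξ => g (0, ξ))
      (hga.comp_of_eq (f := fun ξ : ℝ => ((0 : ℝ), ξ)) (by fun_prop) rfl) (by
        filter_upwards [hax'.eventually (hV.mem_nhds hV0),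
          (tendsto_neg (0 : ℝ)).eventually (by
            simpa using hax'.eventually (hV.mem_nhds hV0))] with ξ h1 h2
        exact hVc _ h2 _ h1 (by simp [hHaxis]))
    have hGH : AnalyticAt ℝ (fun z => G (ham s k z)) 0 :=
      AnalyticAt.comp_of_eq hG (contDiff_ham (r := ω)).contDiffAt.analyticAt hH0
    have hHt : Tendsto (ham s k) (𝓝 0) (𝓝 0) := by
      have := hHc.tendsto (0 : ℝ × ℝ)
      rwa [hH0] at this
    have hsq : Tendsto (fun z => √(ham s k z)) (𝓝 0) (𝓝 0) := by
      have := (Real.continuous_sqrt.tendsto 0).comp hHt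
      rwa [Real.sqrt_zero] at this
    have hpos : ∀ᶠ z in 𝓝 (0 : ℝ × ℝ), 0 ≤ ham s k z → g z = G (ham s k z) := by
      filter_upwards [hsq.eventually hGe, hsq.eventually (hax'.eventually (hV.mem_nhds hV0)),
        hV.mem_nhds hV0] with z h1 h2 h3 h4
      rw [Real.sq_sqrt h4] at h1
      rw [← h1]
      exact hVc _ h3 _ h2 (by rw [hHaxis, Real.sq_sqrt h4])
    obtain ⟨ε, hε, hball⟩ := Metric.eventually_nhds_iff_ball.1
      ((hga.eventually_analyticAt.and hGH.eventually_analyticAt).and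
        (hpos.and (hHt.eventually hG.eventually_analyticAt)))
    have hz1 : ((0 : ℝ), ε / 2) ∈ Metric.ball (0 : ℝ × ℝ) ε := by
      rw [mem_ball_zero_iff, Prod.norm_def]
      simp [abs_of_pos hε, hε]
    -- The second axis only reaches the levels `H ≥ 0`. The identity theorem carries the equality
    -- from the open set `H > 0` to the whole ball.
    have heq : EqOn g (fun z => G (ham s k z)) (Metric.ball 0 ε) := by
      refine AnalyticOnNhd.eqOn_of_preconnected_of_eventuallyEq (z₀ := ((0 : ℝ), ε / 2))
        (fun z hz => (hball z hz).1.1) (fun z hz => (hball z hz).1.2)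
        (convex_ball _ _).isPreconnected hz1 ?_
      have hp : 0 < ham s k (0, ε / 2) := by rw [hHaxis]; positivity
      filter_upwards [Metric.isOpen_ball.mem_nhds hz1, hHc.continuousAt.eventually (lt_mem_nhds hp)]
        with z h1 h2 using (hball z h1).2.1 h2.le
    refine ⟨Metric.ball 0 (min ε ρ), {h | AnalyticAt ℝ G h}, G, Metric.isOpen_ball,
      Metric.mem_ball_self (lt_min hε hρ), Metric.ball_subset_ball (min_le_right _ _),
      isOpen_analyticAt ℝ G,
      fun z hz => (hball z (Metric.ball_subset_ball (min_le_left _ _) hz)).2.2,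
      fun h hh => hh.contDiffAt.contDiffWithinAt,
      fun z hz => heq (Metric.ball_subset_ball (min_le_left _ _) hz)⟩

end OddCase

/-! ### The differential of `φ` at the origin. -/

section LinearPart

variable {s : ℝ} {k : ℕ} {φ : ℝ × ℝ → ℝ × ℝ}

theorem tendsto_slopes (hφ : DifferentiableAt ℝ φ 0) (hφ0 : φ 0 = 0) :
    Tendsto (fun x : ℝ => x⁻¹ * (φ (x, 0)).1) (𝓝[≠] 0) (𝓝 (fderiv ℝ φ 0 (1, 0)).1) ∧
      Tendsto (fun x : ℝ => x⁻¹ * (φ (x, 0)).2) (𝓝[≠] 0) (𝓝 (fderiv ℝ φ 0 (1, 0)).2) := by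
  have h1 : HasDerivAt (fun x : ℝ => (x, (0 : ℝ))) (1, 0) 0 :=
    (hasDerivAt_id (0 : ℝ)).prodMk (hasDerivAt_const _ _)
  have h2 : HasDerivAt (fun x : ℝ => φ (x, 0)) (fderiv ℝ φ 0 (1, 0)) 0 :=
    HasFDerivAt.comp_hasDerivAt (f := fun x : ℝ => (x, (0 : ℝ))) 0 hφ.hasFDerivAt h1
  have h3 := hasDerivAt_iff_tendsto_slope_zero.1 h2
  have h00 : φ (0, 0) = 0 := hφ0
  simp only [zero_add, h00, sub_zero] at h3
  exact ⟨(continuous_fst.tendsto _).comp h3, (continuous_snd.tendsto _).comp h3⟩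

/-- `H ∘ φ = H` on the first axis, written with the slope `φ_x / x`, which has a limit at the
origin. -/
theorem eventually_sq_eq (hφH : ∀ᶠ z in 𝓝 (0 : ℝ × ℝ), ham s k (φ z) = ham s k z) :
    ∀ᶠ x : ℝ in 𝓝[≠] 0,
      (φ (x, 0)).2 ^ 2 = s * x ^ k * (1 - (x⁻¹ * (φ (x, 0)).1) ^ k) := by
  have h1 : Tendsto (fun x : ℝ => (x, (0 : ℝ))) (𝓝[≠] 0) (𝓝 0) :=
    (Continuous.tendsto (by fun_prop) 0).mono_left nhdsWithin_le_nhds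
  filter_upwards [h1.eventually hφH, self_mem_nhdsWithin] with x h2 h3
  have hx : x ≠ 0 := h3
  simp only [ham, ne_eq, OfNat.ofNat_ne_zero, not_false_eq_true, zero_pow, zero_add] at h2
  have h4 : x ^ k * (x⁻¹ * (φ (x, 0)).1) ^ k = (φ (x, 0)).1 ^ k := by
    rw [← mul_pow, mul_inv_cancel_left₀ hx]
  linear_combination h2 + s * h4

/-- After division of `eventually_sq_eq` by `x²` the left side tends to `(∂_x φ_ξ)²` and the right
side is `O(x^(k-2))`. -/
theorem fderiv_snd_eq_zero_of_ham_comp (hk : 2 < k) (hφ : DifferentiableAt ℝ φ 0) (hφ0 : φ 0 = 0)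
    (hφH : ∀ᶠ z in 𝓝 (0 : ℝ × ℝ), ham s k (φ z) = ham s k z) :
    (fderiv ℝ φ 0 (1, 0)).2 = 0 := by
  obtain ⟨h1, h2⟩ := tendsto_slopes hφ hφ0
  have h3 : Tendsto (fun x : ℝ => x ^ (k - 2)) (𝓝[≠] 0) (𝓝 0) := by
    have : Tendsto (fun x : ℝ => x ^ (k - 2)) (𝓝 0) (𝓝 (0 ^ (k - 2))) :=
      (continuous_pow _).tendsto 0
    rw [zero_pow (by omega)] at this
    exact this.mono_left nhdsWithin_le_nhds
  have h4 := (h3.const_mul s).mul ((h1.pow k).const_sub 1)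
  have h5 := tendsto_nhds_unique_of_eventuallyEq (h2.pow 2) h4 (by
    filter_upwards [eventually_sq_eq hφH, self_mem_nhdsWithin] with x hx hx0
    have hx0 : x ≠ 0 := hx0
    have h6 : x ^ k = x ^ (k - 2) * x ^ 2 := by rw [← pow_add]; congr 1; omega
    rw [mul_pow, hx, h6]
    field_simp)
  simpa using h5

/-- With a negative slope, `1 - (φ_x / x)^k` would be positive near the origin; on the half-axis
where `s x^k < 0` the square in `eventually_sq_eq` would be negative. -/
theorem fderiv_fst_nonneg_of_odd (hs : s = 1 ∨ s = -1) (hk : Odd k) (hφ : DifferentiableAt ℝ φ 0)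
    (hφ0 : φ 0 = 0) (hφH : ∀ᶠ z in 𝓝 (0 : ℝ × ℝ), ham s k (φ z) = ham s k z) :
    0 ≤ (fderiv ℝ φ 0 (1, 0)).1 := by
  by_contra! hneg
  obtain ⟨h1, -⟩ := tendsto_slopes hφ hφ0
  have h2 : 0 < 1 - (fderiv ℝ φ 0 (1, 0)).1 ^ k := by
    have := hk.pow_neg hneg
    linarith
  have h3 := ((h1.pow k).const_sub 1).eventually (lt_mem_nhds h2)
  have h4 : Tendsto (fun t : ℝ => -s * t) (𝓝[>] 0) (𝓝[≠] 0) := by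
    refine tendsto_nhdsWithin_iff.2 ⟨?_, ?_⟩
    · have : Tendsto (fun t : ℝ => -s * t) (𝓝 0) (𝓝 (-s * 0)) :=
        Continuous.tendsto (by fun_prop) 0
      rw [mul_zero] at this
      exact this.mono_left nhdsWithin_le_nhds
    · filter_upwards [self_mem_nhdsWithin] with t ht
      have ht : (0 : ℝ) < t := ht
      rcases hs with rfl | rfl <;> simp [ht.ne']
  obtain ⟨t, ⟨h5, h6⟩, ht⟩ :=
    ((h4.eventually ((eventually_sq_eq hφH).and h3)).and self_mem_nhdsWithin).exists
  have ht : (0 : ℝ) < t := ht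
  have h7 : s * (-s * t) ^ k < 0 := by
    have hp := pow_pos ht k
    rcases hs with rfl | rfl
    · rw [neg_one_mul, hk.neg_pow]; linarith
    · simp [hp]
  have h8 := mul_neg_of_neg_of_pos h7 h6
  rw [← h5] at h8
  exact absurd h8 (not_lt.2 (sq_nonneg _))

end LinearPart

/-! ### Division of the displacement of `φ` by `φ_ξ + ξ`. -/

section Factorization

variable {r : WithTop ℕ∞} {s : ℝ} {k : ℕ}

/-- The divided difference `(y ^ k - x ^ k) / (y - x)`. -/
def powDivDiff (k : ℕ) (x y : ℝ) : ℝ := ∑ i ∈ Finset.range k, x ^ i * y ^ (k - 1 - i)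

theorem powDivDiff_mul (k : ℕ) (x y : ℝ) : powDivDiff k x y * (y - x) = y ^ k - x ^ k := by
  have := (Commute.all x y).geom_sum₂_mul k
  unfold powDivDiff
  linear_combination -this

theorem contDiff_powDivDiff (k : ℕ) : ContDiff ℝ r fun p : ℝ × ℝ => powDivDiff k p.1 p.2 := by
  unfold powDivDiff; fun_prop

/-- A skew product of linear maps as a linear equivalence. -/
theorem exists_skew_equiv {E : Type*} [NormedAddCommGroup E] [NormedSpace ℝ E]
    (L : E × ℝ →L[ℝ] ℝ) (hL : L (0, 1) ≠ 0) :
    ∃ e : (E × ℝ) ≃L[ℝ] (E × ℝ),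
      (e : E × ℝ →L[ℝ] E × ℝ) = (ContinuousLinearMap.fst ℝ E ℝ).prod L := by
  have hv : ∀ v : E × ℝ, L v = L (v.1, 0) + v.2 * L (0, 1) := by
    intro v
    conv_lhs => rw [show v = (v.1, 0) + v.2 • ((0 : E), (1 : ℝ)) by ext <;> simp]
    rw [map_add, map_smul, smul_eq_mul]
  let inv : E × ℝ →L[ℝ] E × ℝ := (ContinuousLinearMap.fst ℝ E ℝ).prod
    ((L (0, 1))⁻¹ • (ContinuousLinearMap.snd ℝ E ℝ -
      (L.comp (ContinuousLinearMap.inl ℝ E ℝ)).comp (ContinuousLinearMap.fst ℝ E ℝ)))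
  refine ⟨ContinuousLinearEquiv.equivOfInverse ((ContinuousLinearMap.fst ℝ E ℝ).prod L) inv
    (fun v => ?_) (fun v => ?_), rfl⟩
  · refine Prod.ext rfl ?_
    simp only [inv, ContinuousLinearMap.prod_apply, smul_apply, sub_apply, smul_eq_mul,
      ContinuousLinearMap.coe_snd', ContinuousLinearMap.coe_fst', ContinuousLinearMap.comp_apply,
      ContinuousLinearMap.inl_apply]
    rw [hv v]
    field_simp
    ring
  · refine Prod.ext rfl ?_
    simp only [inv, ContinuousLinearMap.prod_apply, smul_apply, sub_apply, smul_eq_mul,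
      ContinuousLinearMap.coe_snd', ContinuousLinearMap.coe_fst', ContinuousLinearMap.comp_apply,
      ContinuousLinearMap.inl_apply]
    rw [hv]
    field_simp
    ring

/-- Straightening of a function `q` with `∂q/∂ξ ≠ 0`: near the origin `(x, ξ) ↦ (x, q (x, ξ))` has
an inverse of the same class. -/
theorem exists_straightening (hr : r = ∞ ∨ r = ω) {q : ℝ × ℝ → ℝ}
    (hq : ∀ᶠ z in 𝓝 (0 : ℝ × ℝ), ContDiffAt ℝ r q z) (hq0 : q 0 = 0)
    (hd : fderiv ℝ q 0 (0, 1) ≠ 0) :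
    ∃ κ : ℝ × ℝ → ℝ × ℝ, κ 0 = 0 ∧ (∀ᶠ w in 𝓝 0, ContDiffAt ℝ r κ w) ∧
      (∀ᶠ w in 𝓝 0, (κ w).1 = w.1 ∧ q (κ w) = w.2) ∧ ∀ᶠ z in 𝓝 0, κ (z.1, q z) = z := by
  have hr0 := ne_zero_of_infty_or_omega hr
  have hqz := hq.self_of_nhds
  have hder : ∀ z, ContDiffAt ℝ r q z → HasFDerivAt (fun z : ℝ × ℝ => (z.1, q z))
      ((ContinuousLinearMap.fst ℝ ℝ ℝ).prod (fderiv ℝ q z)) z := fun z hz =>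
    hasFDerivAt_fst.prodMk (hz.differentiableAt hr0).hasFDerivAt
  obtain ⟨e, he⟩ := exists_skew_equiv (fderiv ℝ q 0) hd
  have hc : ContDiffAt ℝ r (fun z : ℝ × ℝ => (z.1, q z)) 0 := contDiffAt_fst.prodMk hqz
  have hd0 : HasFDerivAt (fun z : ℝ × ℝ => (z.1, q z)) (e : ℝ × ℝ →L[ℝ] ℝ × ℝ) 0 := by
    rw [he]; exact hder 0 hqz
  let Φ := hc.toOpenPartialHomeomorph _ hd0 hr0
  have hΦ : ∀ z, Φ z = (z.1, q z) := fun z => rfl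
  have h0s : (0 : ℝ × ℝ) ∈ Φ.source := hc.mem_toOpenPartialHomeomorph_source hd0 hr0
  have hΦ0 : Φ 0 = 0 := by rw [hΦ, hq0]; rfl
  have h0t : (0 : ℝ × ℝ) ∈ Φ.target := hΦ0 ▸ Φ.map_source h0s
  have hκ0 : Φ.symm 0 = 0 := by
    have := Φ.left_inv h0s
    rwa [hΦ0] at this
  have hκt : Tendsto Φ.symm (𝓝 0) (𝓝 0) := by
    have := (Φ.continuousAt_symm h0t).tendsto
    rwa [hκ0] at this
  have hne : ∀ᶠ z in 𝓝 (0 : ℝ × ℝ), fderiv ℝ q z (0, 1) ≠ 0 := by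
    have h1 : ContinuousAt (fun z => fderiv ℝ q z (0, 1)) 0 :=
      (hqz.fderiv_right (add_one_le_of_infty_or_omega hr)).continuousAt.clm_apply
        continuousAt_const
    exact h1.eventually_ne hd
  refine ⟨Φ.symm, hκ0, ?_, ?_, ?_⟩
  -- The differential stays invertible near the origin, which gives the regularity of the inverse on
  -- a whole neighbourhood.
  · filter_upwards [Φ.open_target.mem_nhds h0t, hκt.eventually (hq.and hne)] with w hw hw2
    obtain ⟨e', he'⟩ := exists_skew_equiv (fderiv ℝ q (Φ.symm w)) hw2.2
    refine Φ.contDiffAt_symm hw (f₀' := e') ?_ (contDiffAt_fst.prodMk hw2.1)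
    rw [he']
    exact hder _ hw2.1
  · filter_upwards [Φ.open_target.mem_nhds h0t] with w hw
    have := Φ.right_inv hw
    rw [hΦ] at this
    exact Prod.mk.inj this
  · filter_upwards [Φ.open_source.mem_nhds h0s] with z hz
    exact Φ.left_inv hz

/-- A map `φ` that preserves `H` and is close to the identity to first order satisfies
`φ_x - x = (φ_ξ + ξ) σ` and `φ_ξ - ξ = - s P(x, φ_x) σ`, with `σ` of the same class. -/
theorem exists_factor (hr : r = ∞ ∨ r = ω) (hs : s ≠ 0) (hk : 2 < k) {φ : ℝ × ℝ → ℝ × ℝ}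
    (hφ : ∀ᶠ z in 𝓝 (0 : ℝ × ℝ), ContDiffAt ℝ r φ z) (hφ0 : φ 0 = 0)
    (hφH : ∀ᶠ z in 𝓝 (0 : ℝ × ℝ), ham s k (φ z) = ham s k z)
    (ha : 0 < (fderiv ℝ φ 0 (1, 0)).1) (hc : (fderiv ℝ φ 0 (1, 0)).2 = 0)
    (hd : 0 < (fderiv ℝ φ 0 (0, 1)).2) :
    ∃ σ : ℝ × ℝ → ℝ, (∀ᶠ z in 𝓝 0, ContDiffAt ℝ r σ z) ∧
      ∀ᶠ z in 𝓝 0, (φ z).1 - z.1 = ((φ z).2 + z.2) * σ z ∧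
        (φ z).2 - z.2 = -s * powDivDiff k z.1 (φ z).1 * σ z := by
  have hr0 := ne_zero_of_infty_or_omega hr
  set q : ℝ × ℝ → ℝ := fun z => (φ z).2 + z.2 with hq
  have hφd := (hφ.self_of_nhds.differentiableAt hr0).hasFDerivAt
  have hqc : ∀ᶠ z in 𝓝 (0 : ℝ × ℝ), ContDiffAt ℝ r q z := by
    filter_upwards [hφ] with z hz
    exact (contDiffAt_snd.comp z hz).add contDiffAt_snd
  have hqd : fderiv ℝ q 0 (0, 1) ≠ 0 := by
    have h1 : HasFDerivAt q ((ContinuousLinearMap.snd ℝ ℝ ℝ).comp (fderiv ℝ φ 0) +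
        ContinuousLinearMap.snd ℝ ℝ ℝ) 0 :=
      (hasFDerivAt_snd.comp 0 hφd).add hasFDerivAt_snd
    rw [h1.fderiv]
    simp only [add_apply, ContinuousLinearMap.comp_apply, ContinuousLinearMap.coe_snd']
    positivity
  -- The triangular matrix `dφ(0) + id` has positive diagonal, hence is injective. This will exclude
  -- the solution `φ(z) = -z`.
  have hne : ∀ᶠ z in 𝓝 (0 : ℝ × ℝ), φ z + z = 0 → z = 0 := by
    have h1 : HasFDerivAt (fun z => φ z + z) (fderiv ℝ φ 0 + ContinuousLinearMap.id ℝ (ℝ × ℝ)) 0 :=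
      hφd.add (hasFDerivAt_id 0)
    have hker : (fderiv ℝ φ 0 + ContinuousLinearMap.id ℝ (ℝ × ℝ) :
        ℝ × ℝ →L[ℝ] ℝ × ℝ).toLinearMap.ker = ⊥ := by
      refine LinearMap.ker_eq_bot'.2 fun v hv => ?_
      have hv' : fderiv ℝ φ 0 v + v = 0 := hv
      have h2 : fderiv ℝ φ 0 v = v.1 • fderiv ℝ φ 0 (1, 0) + v.2 • fderiv ℝ φ 0 (0, 1) := by
        conv_lhs => rw [show v = v.1 • ((1 : ℝ), (0 : ℝ)) + v.2 • ((0 : ℝ), (1 : ℝ)) by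
          ext <;> simp]
        rw [map_add, map_smul, map_smul]
      rw [h2] at hv'
      have e1 := congrArg Prod.fst hv'
      have e2 := congrArg Prod.snd hv'
      simp only [Prod.fst_add, Prod.snd_add, Prod.smul_fst, Prod.smul_snd, smul_eq_mul, hc,
        Prod.fst_zero, Prod.snd_zero] at e1 e2
      have e3 : v.2 = 0 := by
        have : v.2 * ((fderiv ℝ φ 0 (0, 1)).2 + 1) = 0 := by linear_combination e2
        exact (mul_eq_zero.1 this).resolve_right (by positivity)
      have e4 : v.1 = 0 := by
        have : v.1 * ((fderiv ℝ φ 0 (1, 0)).1 + 1) = 0 := by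
          rw [e3] at e1
          linear_combination e1
        exact (mul_eq_zero.1 this).resolve_right (by positivity)
      exact Prod.ext e4 e3
    obtain ⟨K, -, hK⟩ := LinearMap.exists_antilipschitzWith _ hker
    have h3 := h1.eventually_ne (c := 0) ⟨K, hK⟩
    rw [eventually_nhdsWithin_iff] at h3
    filter_upwards [h3] with z hz hz0
    by_contra hzz
    exact hz hzz hz0
  obtain ⟨κ, hκ0, hκc, hκr, hκl⟩ := exists_straightening hr hqc (by simp [hq, hφ0]) hqd
  have hκt : Tendsto κ (𝓝 0) (𝓝 0) := by
    have := hκc.self_of_nhds.continuousAt.tendsto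
    rwa [hκ0] at this
  obtain ⟨ε, hε, hball⟩ := Metric.eventually_nhds_iff_ball.1
    ((hκc.and hκr).and (hκt.eventually ((hφ.and hφH).and hne)))
  have hwc : ∀ w ∈ Metric.ball (0 : ℝ × ℝ) ε, ContDiffAt ℝ r (fun w => φ (κ w)) w := fun w hw =>
    (hball w hw).2.1.1.comp w (hball w hw).1.1
  -- Where `φ_ξ = -ξ`, conservation of `H` leaves `φ_x = ± x`; the sign `-` means `φ(z) = -z`,
  -- possible only at the origin.
  have hu0 : ∀ x, (x, (0 : ℝ)) ∈ Metric.ball (0 : ℝ × ℝ) ε →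
      (φ (κ (x, 0))).1 - (x, (0 : ℝ)).1 = 0 := by
    intro x hx
    obtain ⟨⟨-, h1, h2⟩, ⟨-, h3⟩, h4⟩ := hball _ hx
    have h5 : (φ (κ (x, 0))).2 = -(κ (x, 0)).2 := by
      simp only [hq] at h2
      linarith
    simp only [ham, h5, h1] at h3
    have h6 : (φ (κ (x, 0))).1 ^ k = x ^ k := by
      have : s * ((φ (κ (x, 0))).1 ^ k - x ^ k) = 0 := by linear_combination h3
      have := (mul_eq_zero.1 this).resolve_left hs
      linarith
    have h7 : |(φ (κ (x, 0))).1| = |x| := by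
      rw [← pow_left_inj₀ (abs_nonneg _) (abs_nonneg _) (by omega : k ≠ 0), ← abs_pow, h6, abs_pow]
    rcases abs_eq_abs.1 h7 with h8 | h8
    · simp [h8]
    · have h9 : κ (x, 0) = 0 := h4 (Prod.ext (by simp [h8, h1]) (by simp [h5]))
      have h10 : x = 0 := by rw [h9] at h1; exact h1.symm
      rw [h9, hφ0, h10]
      simp
  obtain ⟨l, hl, hlw⟩ := exists_eq_snd_mul hr
    (F := fun w => (φ (κ w)).1 - w.1)
    (fun w hw => (contDiffAt_fst.comp w (hwc w hw)).sub contDiffAt_fst) hu0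
  -- `H ∘ φ = H` is this equation multiplied by the coordinate `φ_ξ + ξ`, which is cancelled by
  -- density.
  have hv : ∀ w ∈ Metric.ball (0 : ℝ × ℝ) ε,
      (φ (κ w)).2 - (κ w).2 = -s * powDivDiff k (κ w).1 (φ (κ w)).1 * l w := by
    intro w hw
    have hφκ := (hwc w hw).continuousAt
    have hκw := (hball w hw).1.1.continuousAt
    have hlc := (hl w hw).continuousAt
    refine eq_of_eventually_snd_ne_zero_imp_eq (a := fun w => (φ (κ w)).2 - (κ w).2)
      (b := fun w => -s * powDivDiff k (κ w).1 (φ (κ w)).1 * l w) ?_ ?_ ?_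
    · exact (continuousAt_snd.comp hφκ).sub (continuousAt_snd.comp hκw)
    · have hP := ((contDiff_powDivDiff (r := 0) k).continuous.continuousAt).comp
        ((continuousAt_fst.comp hκw).prodMk (continuousAt_fst.comp hφκ))
      exact (continuousAt_const.mul hP).mul hlc
    · filter_upwards [Metric.isOpen_ball.mem_nhds hw] with z hz hz2
      obtain ⟨⟨-, h1, h2⟩, ⟨-, h3⟩, -⟩ := hball z hz
      have h4 : (φ (κ z)).1 - z.1 = z.2 * l z := hlw z hz
      have h5 := powDivDiff_mul k (κ z).1 (φ (κ z)).1
      simp only [hq] at h2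
      simp only [ham] at h3
      have h6 : z.2 * ((φ (κ z)).2 - (κ z).2 + s * powDivDiff k (κ z).1 (φ (κ z)).1 * l z) = 0 := by
        rw [← h1] at h4
        linear_combination h3 - (φ (κ z)).2 * h2 + (κ z).2 * h2 -
          s * powDivDiff k (κ z).1 (φ (κ z)).1 * h4 + s * h5
      have := (mul_eq_zero.1 h6).resolve_left hz2
      linarith
  have ht : Tendsto (fun z : ℝ × ℝ => (z.1, q z)) (𝓝 0) (𝓝 0) := by
    have h1 : ContinuousAt (fun z : ℝ × ℝ => (z.1, q z)) 0 :=
      continuousAt_fst.prodMk hqc.self_of_nhds.continuousAt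
    have h2 : ((0 : ℝ × ℝ).1, q 0) = 0 := by simp [hq, hφ0]
    have := h1.tendsto
    rwa [h2] at this
  have hmem := ht.eventually (Metric.ball_mem_nhds (0 : ℝ × ℝ) hε)
  refine ⟨fun z => l (z.1, q z), ?_, ?_⟩
  · filter_upwards [hmem, hqc] with z h1 h2
    exact (hl _ h1).comp z (contDiffAt_fst.prodMk h2)
  · filter_upwards [hmem, hκl] with z h1 h2
    have h3 := hlw _ h1
    have h4 := hv _ h1
    simp only [h2] at h3 h4
    exact ⟨h3, h4⟩

end Factorization

/-! ### The family joining the identity to `φ`. -/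

section ImplicitFamily

variable {r : WithTop ℕ∞} {s : ℝ} {k : ℕ}

/-- The derivative of `powDivDiff k x y` with respect to `y`. -/
def powDivDiffDeriv (k : ℕ) (x y : ℝ) : ℝ :=
  ∑ i ∈ Finset.range k, x ^ i * ((k - 1 - i : ℕ) * y ^ (k - 1 - i - 1))

theorem hasDerivAt_powDivDiff (k : ℕ) (x y : ℝ) :
    HasDerivAt (fun y => powDivDiff k x y) (powDivDiffDeriv k x y) y := by
  unfold powDivDiff powDivDiffDeriv
  exact HasDerivAt.fun_sum fun i _ => (hasDerivAt_pow (k - 1 - i) y).const_mul (x ^ i)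

/-- Differentiate `P(x, y)(y - x) = y^k - x^k` in `y`. The result brings `H_x` at the moved point
into the velocity of the family. -/
theorem powDivDiff_add (k : ℕ) (x y : ℝ) :
    powDivDiff k x y + (y - x) * powDivDiffDeriv k x y = k * y ^ (k - 1) := by
  have h1 := (hasDerivAt_powDivDiff k x y).mul ((hasDerivAt_id y).sub_const x)
  have h2 : HasDerivAt (fun y : ℝ => powDivDiff k x y * (y - x)) (k * y ^ (k - 1)) y := by
    simp only [powDivDiff_mul]
    exact (hasDerivAt_pow k y).sub_const _
  have h3 := h1.unique h2
  simp only [id] at h3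
  linear_combination h3

theorem contDiff_powDivDiffDeriv (k : ℕ) :
    ContDiff ℝ r fun p : ℝ × ℝ => powDivDiffDeriv k p.1 p.2 := by
  unfold powDivDiffDeriv; fun_prop

theorem powDivDiff_self_zero (hk : 2 < k) : powDivDiff k 0 0 = 0 := by
  have := powDivDiff_add k 0 0
  simpa [show k - 1 ≠ 0 by omega] using this

theorem powDivDiffDeriv_zero (hk : 2 < k) : powDivDiffDeriv k 0 0 = 0 := by
  refine Finset.sum_eq_zero fun i hi => ?_
  rcases Nat.eq_zero_or_pos i with rfl | h
  · rw [zero_pow (by omega : k - 1 - 0 - 1 ≠ 0)]; simp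
  · rw [zero_pow h.ne', zero_mul]

/-- The function whose zeros `y`, for `p = (σ, (x, ξ))`, define a family of maps that preserve
`H`. -/
def familyEqn (s : ℝ) (k : ℕ) (p : ℝ × (ℝ × ℝ)) (y : ℝ) : ℝ :=
  y - p.2.1 - 2 * p.1 * p.2.2 + s * p.1 ^ 2 * powDivDiff k p.2.1 y

theorem hasDerivAt_familyEqn (p : ℝ × (ℝ × ℝ)) (y : ℝ) : HasDerivAt (familyEqn s k p)
    (1 + s * p.1 ^ 2 * powDivDiffDeriv k p.2.1 y) y :=
  (((hasDerivAt_id y).sub_const _).sub_const _).add ((hasDerivAt_powDivDiff k p.2.1 y).const_mul _)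

theorem contDiff_familyEqn :
    ContDiff ℝ r fun u : (ℝ × (ℝ × ℝ)) × ℝ => familyEqn s k u.1 u.2 := by
  unfold familyEqn
  have : ContDiff ℝ r fun u : (ℝ × (ℝ × ℝ)) × ℝ => powDivDiff k u.1.2.1 u.2 :=
    (contDiff_powDivDiff k).comp (f := fun u : (ℝ × (ℝ × ℝ)) × ℝ => (u.1.2.1, u.2)) (by fun_prop)
  fun_prop

/-- `P` and `∂P/∂y` vanish at the origin, so for bounded `p.1` and small `(x, ξ)` the equation has
slope greater than `1/2` on `[-ρ, ρ]` and a value of size below `ρ/2` at `0`: exactly one root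
there. A local implicit function alone would not cover all `|p.1| < R`; it is used for the
regularity, and uniqueness identifies it with `Y`. -/
theorem exists_familyEqn_root (hr : r ≠ 0) (hs : s = 1 ∨ s = -1) (hk : 2 < k) (R : ℝ) :
    ∃ ρ > 0, ∃ ε > 0, ∃ Y : ℝ × (ℝ × ℝ) → ℝ, ∀ p : ℝ × (ℝ × ℝ), |p.1| < R →
      p.2 ∈ Metric.ball (0 : ℝ × ℝ) ε → familyEqn s k p (Y p) = 0 ∧
        (∀ y, |y| < ρ → familyEqn s k p y = 0 → y = Y p) ∧ ContDiffAt ℝ r Y p ∧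
        0 < 1 + s * p.1 ^ 2 * powDivDiffDeriv k p.2.1 (Y p) := by
  have hs1 : |s| = 1 := by rcases hs with rfl | rfl <;> simp
  obtain ⟨ρ₀, hρ₀, hP⟩ : ∃ ρ₀ > 0, ∀ w ∈ Metric.ball (0 : ℝ × ℝ) ρ₀,
      R ^ 2 * |powDivDiffDeriv k w.1 w.2| < 1 / 2 := by
    have h1 : ContinuousAt (fun w : ℝ × ℝ => R ^ 2 * |powDivDiffDeriv k w.1 w.2|) 0 := by
      have := (contDiff_powDivDiffDeriv (r := 0) k).continuous
      fun_prop
    have h2 : R ^ 2 * |powDivDiffDeriv k (0 : ℝ × ℝ).1 (0 : ℝ × ℝ).2| < 1 / 2 := by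
      simp [powDivDiffDeriv_zero hk]
    exact Metric.eventually_nhds_iff_ball.1 (h1.eventually (gt_mem_nhds h2))
  set ρ := ρ₀ / 2 with hρ
  have hρ0 : 0 < ρ := by positivity
  obtain ⟨ε₁, hε₁, hF0⟩ : ∃ ε₁ > 0, ∀ z ∈ Metric.ball (0 : ℝ × ℝ) ε₁,
      |z.1| + 2 * R * |z.2| + R ^ 2 * |powDivDiff k z.1 0| < ρ / 2 := by
    have h1 : ContinuousAt (fun z : ℝ × ℝ =>
        |z.1| + 2 * R * |z.2| + R ^ 2 * |powDivDiff k z.1 0|) 0 := by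
      have : Continuous fun z : ℝ × ℝ => powDivDiff k z.1 0 :=
        (contDiff_powDivDiff (r := 0) k).continuous.comp
          (f := fun z : ℝ × ℝ => (z.1, (0 : ℝ))) (by fun_prop)
      fun_prop
    have h2 : |(0 : ℝ × ℝ).1| + 2 * R * |(0 : ℝ × ℝ).2| +
        R ^ 2 * |powDivDiff k (0 : ℝ × ℝ).1 0| < ρ / 2 := by
      simp [powDivDiff_self_zero hk, hρ0]
    exact Metric.eventually_nhds_iff_ball.1 (h1.eventually (gt_mem_nhds h2))
  have hmem : ∀ p : ℝ × (ℝ × ℝ), |p.1| < R → p.2 ∈ Metric.ball (0 : ℝ × ℝ) (min ε₁ ρ) →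
      ∀ y ∈ Icc (-ρ) ρ, 1 / 2 < 1 + s * p.1 ^ 2 * powDivDiffDeriv k p.2.1 y := by
    intro p hp1 hp2 y hy
    have hp2' : |p.2.1| < ρ := by
      rw [mem_ball_zero_iff, Prod.norm_def, max_lt_iff] at hp2
      exact hp2.1.trans_le (min_le_right _ _)
    have h1 := hP (p.2.1, y) (by
      rw [mem_ball_zero_iff, Prod.norm_def, max_lt_iff]
      exact ⟨by simpa using hp2'.trans (by linarith), (abs_le.2 hy).trans_lt (by linarith)⟩)
    have h2 : |s * p.1 ^ 2 * powDivDiffDeriv k p.2.1 y| < 1 / 2 := by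
      rw [abs_mul, abs_mul, hs1, one_mul, abs_pow]
      refine lt_of_le_of_lt ?_ h1
      gcongr
    have := (abs_lt.1 h2).1
    linarith
  have hmono : ∀ p : ℝ × (ℝ × ℝ), |p.1| < R → p.2 ∈ Metric.ball (0 : ℝ × ℝ) (min ε₁ ρ) →
      MonotoneOn (fun y => familyEqn s k p y - y / 2) (Icc (-ρ) ρ) := by
    intro p hp1 hp2
    have hd : ∀ y, HasDerivAt (fun y => familyEqn s k p y - y / 2)
        (1 + s * p.1 ^ 2 * powDivDiffDeriv k p.2.1 y - 1 / 2) y := fun y =>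
      (hasDerivAt_familyEqn p y).sub ((hasDerivAt_id y).div_const 2)
    refine monotoneOn_of_deriv_nonneg (convex_Icc _ _)
      (fun y _ => (hd y).continuousAt.continuousWithinAt)
      (fun y _ => (hd y).differentiableAt.differentiableWithinAt) fun y hy => ?_
    rw [(hd y).deriv]
    have := hmem p hp1 hp2 y (interior_subset hy)
    linarith
  have hex : ∀ p : ℝ × (ℝ × ℝ), |p.1| < R → p.2 ∈ Metric.ball (0 : ℝ × ℝ) (min ε₁ ρ) →
      ∃ y, |y| < ρ ∧ familyEqn s k p y = 0 := by
    intro p hp1 hp2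
    have h0 : |familyEqn s k p 0| < ρ / 2 := by
      refine lt_of_le_of_lt ?_ (hF0 p.2 (Metric.ball_subset_ball (min_le_left _ _) hp2))
      have e : familyEqn s k p 0 =
          -p.2.1 + -(2 * p.1 * p.2.2) + s * p.1 ^ 2 * powDivDiff k p.2.1 0 := by
        unfold familyEqn; ring
      rw [e]
      refine (abs_add_three _ _ _).trans ?_
      simp only [abs_neg, abs_mul, hs1, one_mul, abs_pow, abs_two]
      gcongr
    have hm := hmono p hp1 hp2
    have h1 := hm (a := 0) (b := ρ) ⟨by linarith, hρ0.le⟩ ⟨by linarith, le_rfl⟩ hρ0.le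
    have h2 := hm (a := -ρ) (b := 0) ⟨le_rfl, by linarith⟩ ⟨by linarith, hρ0.le⟩ (by linarith)
    simp only at h1 h2
    have h3 := abs_lt.1 h0
    have hc : ContinuousOn (familyEqn s k p) (Icc (-ρ) ρ) := fun y _ =>
      (hasDerivAt_familyEqn p y).continuousAt.continuousWithinAt
    obtain ⟨y, hy, hy0⟩ := intermediate_value_Ioo (by linarith) hc
      (show (0 : ℝ) ∈ Ioo _ _ from ⟨by linarith, by linarith⟩)
    exact ⟨y, abs_lt.2 hy, hy0⟩
  have huniq : ∀ p : ℝ × (ℝ × ℝ), |p.1| < R → p.2 ∈ Metric.ball (0 : ℝ × ℝ) (min ε₁ ρ) →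
      ∀ y y', |y| < ρ → |y'| < ρ → familyEqn s k p y = 0 → familyEqn s k p y' = 0 → y ≤ y' := by
    intro p hp1 hp2 y y' hy hy' h h'
    by_contra! hlt
    have h1 := hmono p hp1 hp2 (a := y') (b := y) ⟨(abs_lt.1 hy').1.le, (abs_lt.1 hy').2.le⟩
      ⟨(abs_lt.1 hy).1.le, (abs_lt.1 hy).2.le⟩ hlt.le
    simp only [h, h'] at h1
    linarith
  choose! Y hY using hex
  refine ⟨ρ, hρ0, min ε₁ ρ, lt_min hε₁ hρ0, Y, fun p hp1 hp2 => ?_⟩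
  obtain ⟨hYρ, hY0⟩ := hY p hp1 hp2
  have hD := hmem p hp1 hp2 (Y p) ⟨(abs_lt.1 hYρ).1.le, (abs_lt.1 hYρ).2.le⟩
  have hun : ∀ p : ℝ × (ℝ × ℝ), |p.1| < R → p.2 ∈ Metric.ball (0 : ℝ × ℝ) (min ε₁ ρ) →
      ∀ y, |y| < ρ → familyEqn s k p y = 0 → y = Y p := fun p hp1 hp2 y hy h =>
    le_antisymm (huniq p hp1 hp2 y (Y p) hy (hY p hp1 hp2).1 h (hY p hp1 hp2).2)
      (huniq p hp1 hp2 (Y p) y (hY p hp1 hp2).1 hy (hY p hp1 hp2).2 h)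
  refine ⟨hY0, hun p hp1 hp2, ?_, by linarith⟩
  have hF : ContDiffAt ℝ r (fun u : (ℝ × (ℝ × ℝ)) × ℝ => familyEqn s k u.1 u.2) (p, Y p) :=
    contDiff_familyEqn.contDiffAt
  have hFd := (hF.differentiableAt hr).hasFDerivAt
  have h1 := (hFd.comp_hasDerivAt (Y p)
    ((hasDerivAt_const (Y p) p).prodMk (hasDerivAt_id (Y p)))).unique
    (hasDerivAt_familyEqn p (Y p))
  have hinv : (fderiv ℝ (fun u : (ℝ × (ℝ × ℝ)) × ℝ => familyEqn s k u.1 u.2) (p, Y p) ∘L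
      .inr ℝ (ℝ × (ℝ × ℝ)) ℝ).IsInvertible := by
    refine ⟨ContinuousLinearEquiv.unitsEquivAut ℝ (Units.mk0
      (1 + s * p.1 ^ 2 * powDivDiffDeriv k p.2.1 (Y p)) (by linarith)), ?_⟩
    ext
    simpa using h1.symm
  have hψ := hF.contDiffAt_implicitFunction hr hinv
  have hψ0 := hF.implicitFunction_apply_self hr hinv
  have hψe := hF.eventually_apply_implicitFunction hr hinv
  refine hψ.congr_of_eventuallyEq ?_
  have hψc : ContinuousAt (fun p => |hF.implicitFunction hr hinv p|) p :=
    (hψ.continuousAt : ContinuousAt (hF.implicitFunction hr hinv) p).abs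
  have hlt : |hF.implicitFunction hr hinv p| < ρ := by
    have : hF.implicitFunction hr hinv p = Y p := hψ0
    rwa [this]
  have hfst : ContinuousAt (fun p : ℝ × (ℝ × ℝ) => |p.1|) p := by fun_prop
  filter_upwards [hψe, hψc.eventually (gt_mem_nhds hlt), hfst.eventually (gt_mem_nhds hp1),
    continuousAt_snd.eventually (Metric.isOpen_ball.mem_nhds hp2)] with p' e1 e2 e3 e4
  exact (hun p' e3 e4 _ e2 (e1.trans hY0)).symm

/-- The bound `2` just provides an open interval of parameters containing `[0, 1]`. -/
theorem eventually_forall_abs_lt_two_mul_lt {σ : ℝ × ℝ → ℝ} (hσ : ContinuousAt σ 0) :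
    ∃ R : ℝ, ∀ᶠ z in 𝓝 (0 : ℝ × ℝ), ∀ θ : ℝ, |θ| < 2 → |θ * σ z| < R := by
  refine ⟨2 * (|σ 0| + 1), ?_⟩
  filter_upwards [hσ.abs.eventually (gt_mem_nhds (lt_add_one |σ 0|))] with z hz θ hθ
  rw [abs_mul]
  have := abs_nonneg (σ z)
  have := abs_nonneg θ
  nlinarith

/-- A map `φ` as in `exists_factor` is joined to the identity by a family of maps that preserve `H`
and move along the vector field `H_ξ ∂_x - H_x ∂_ξ`. -/
theorem exists_family (hr : r = ∞ ∨ r = ω) (hs : s = 1 ∨ s = -1) (hk : 2 < k)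
    {φ : ℝ × ℝ → ℝ × ℝ} (hφ : ContinuousAt φ 0) (hφ0 : φ 0 = 0)
    {σ : ℝ × ℝ → ℝ} (hσ : ∀ᶠ z in 𝓝 0, ContDiffAt ℝ r σ z)
    (hσφ : ∀ᶠ z in 𝓝 (0 : ℝ × ℝ), (φ z).1 - z.1 = ((φ z).2 + z.2) * σ z ∧
        (φ z).2 - z.2 = -s * powDivDiff k z.1 (φ z).1 * σ z) :
    ∃ (Q : ℝ × (ℝ × ℝ) → ℝ × ℝ) (ν : ℝ × (ℝ × ℝ) → ℝ), ∀ᶠ z in 𝓝 (0 : ℝ × ℝ),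
      Q (0, z) = z ∧ Q (1, z) = φ z ∧ ∀ θ : ℝ, |θ| < 2 → Q (θ, 0) = 0 ∧
        ContDiffAt ℝ r Q (θ, z) ∧ ContDiffAt ℝ r ν (θ, z) ∧ 0 < ν (θ, z) ∧
        ham s k (Q (θ, z)) = ham s k z ∧
        HasDerivAt (fun θ => Q (θ, z)) ((σ z * ν (θ, z)) •
          ((2 * (Q (θ, z)).2, -(s * (k * (Q (θ, z)).1 ^ (k - 1)))) : ℝ × ℝ)) θ := by
  have hr0 := ne_zero_of_infty_or_omega hr
  obtain ⟨R, hθR⟩ := eventually_forall_abs_lt_two_mul_lt hσ.self_of_nhds.continuousAt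
  obtain ⟨ρ, hρ, ε, hε, Y, hY⟩ := exists_familyEqn_root (r := r) hr0 hs hk R
  -- With `σ` replaced by `θ σ`, the image `(y, η)` is to satisfy `y - x = (η + ξ) θ σ` and `η - ξ =
  -- -s P(x, y) θ σ`. Eliminating `η` gives `familyEqn`; multiplying the relations crosswise shows
  -- that `H` is preserved.
  let a : ℝ × (ℝ × ℝ) → ℝ × (ℝ × ℝ) := fun p => (p.1 * σ p.2, p.2)
  let D : ℝ × (ℝ × ℝ) → ℝ := fun p =>
    1 + s * (a p).1 ^ 2 * powDivDiffDeriv k p.2.1 (Y (a p))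
  let Q : ℝ × (ℝ × ℝ) → ℝ × ℝ := fun p =>
    (Y (a p), p.2.2 - s * (a p).1 * powDivDiff k p.2.1 (Y (a p)))
  have hY00 : ∀ θ : ℝ, |θ| < 2 → Y (a (θ, 0)) = 0 := fun θ hθ => by
    refine ((hY (a (θ, 0)) (hθR.self_of_nhds θ hθ) (Metric.mem_ball_self hε)).2.1 0
      (by simpa using hρ) ?_).symm
    simp [familyEqn, a, powDivDiff_self_zero hk]
  have hφ1 : ∀ᶠ z in 𝓝 (0 : ℝ × ℝ), |(φ z).1| < ρ := by
    refine ContinuousAt.eventually_lt (f := fun z => |(φ z).1|)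
      (continuousAt_fst.comp hφ).abs continuousAt_const ?_
    simp [hφ0, hρ]
  have hz1 : ∀ᶠ z in 𝓝 (0 : ℝ × ℝ), |z.1| < ρ := by
    refine ContinuousAt.eventually_lt (f := fun z : ℝ × ℝ => |z.1|) (by fun_prop)
      continuousAt_const ?_
    simp [hρ]
  refine ⟨Q, fun p => (D p)⁻¹, ?_⟩
  filter_upwards [hσ, hσφ, hθR, Metric.ball_mem_nhds (0 : ℝ × ℝ) hε, hφ1, hz1]
    with z hσz hφz hRz hεz hφρ hzρ
  refine ⟨?_, ?_, fun θ hθ => ?_⟩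
  · have h1 : Y (a (0, z)) = z.1 := by
      refine ((hY (a (0, z)) (hRz 0 (by simp)) hεz).2.1 z.1 hzρ ?_).symm
      simp [familyEqn, a]
    refine Prod.ext h1 ?_
    simp [Q, a]
  -- For `θ = 1` the point `φ z` solves the same equations, so uniqueness of the small root applies.
  · have h1 : Y (a (1, z)) = (φ z).1 := by
      refine ((hY (a (1, z)) (hRz 1 (by norm_num)) hεz).2.1 (φ z).1 hφρ ?_).symm
      simp only [familyEqn, a, one_mul]
      linear_combination hφz.1 + σ z * hφz.2
    refine Prod.ext h1 ?_
    simp only [Q, h1]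
    simp only [a, one_mul]
    linear_combination -hφz.2
  obtain ⟨h0, -, hYc, hDpos⟩ := hY (a (θ, z)) (hRz θ hθ) hεz
  have hac : ContDiffAt ℝ r a (θ, z) :=
    (contDiffAt_fst.mul (hσz.comp (θ, z) contDiffAt_snd)).prodMk contDiffAt_snd
  have hYac : ContDiffAt ℝ r (fun p => Y (a p)) (θ, z) := hYc.comp (θ, z) hac
  have ha1 : ContDiffAt ℝ r (fun p => (a p).1) (θ, z) := contDiffAt_fst.comp (θ, z) hac
  have hx : ContDiffAt ℝ r (fun p : ℝ × (ℝ × ℝ) => p.2.1) (θ, z) := by fun_prop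
  have hDc : ContDiffAt ℝ r D (θ, z) :=
    contDiffAt_const.add ((contDiffAt_const.mul (ha1.pow 2)).mul
      ((contDiff_powDivDiffDeriv k).contDiffAt.comp (θ, z) (hx.prodMk hYac)))
  have hPc : ContDiffAt ℝ r (fun p : ℝ × (ℝ × ℝ) => powDivDiff k p.2.1 (Y (a p))) (θ, z) :=
    (contDiff_powDivDiff k).contDiffAt.comp (θ, z) (hx.prodMk hYac)
  have hDθ : 0 < D (θ, z) := hDpos
  refine ⟨?_, ?_, hDc.inv hDθ.ne', inv_pos.2 hDθ, ?_, ?_⟩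
  · simp [Q, hY00 θ hθ, powDivDiff_self_zero hk]
  · refine hYac.prodMk ?_
    have : ContDiffAt ℝ r (fun p : ℝ × (ℝ × ℝ) => p.2.2) (θ, z) := by fun_prop
    exact this.sub ((contDiffAt_const.mul ha1).mul hPc)
  · have h2 := powDivDiff_mul k z.1 (Y (a (θ, z)))
    simp only [familyEqn, a] at h0
    simp only [ham, Q, a] at h2 ⊢
    linear_combination (-s) * h2 + s * powDivDiff k z.1 (Y (θ * σ z, z)) * h0
  · have hY1 : HasDerivAt (fun θ => Y (a (θ, z))) (fderiv ℝ (fun p => Y (a p)) (θ, z) (1, 0)) θ :=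
      HasFDerivAt.comp_hasDerivAt (f := fun θ : ℝ => (θ, z)) θ
        (hYac.differentiableAt hr0).hasFDerivAt ((hasDerivAt_id θ).prodMk (hasDerivAt_const θ z))
    set Y' := fderiv ℝ (fun p => Y (a p)) (θ, z) (1, 0) with hY'
    have ha' : HasDerivAt (fun θ => θ * σ z) (σ z) θ := by
      simpa using (hasDerivAt_id θ).mul_const (σ z)
    have hP1 : HasDerivAt (fun θ => powDivDiff k z.1 (Y (a (θ, z))))
        (powDivDiffDeriv k z.1 (Y (a (θ, z))) * Y') θ :=
      HasDerivAt.comp (h₂ := fun y => powDivDiff k z.1 y) θ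
        (hasDerivAt_powDivDiff k z.1 (Y (a (θ, z)))) hY1
    have hE := ((hY1.sub_const z.1).sub ((ha'.const_mul 2).mul_const z.2)).add
      (((ha'.pow 2).const_mul s).mul hP1)
    have hE0 : (fun θ => familyEqn s k (a (θ, z)) (Y (a (θ, z)))) =ᶠ[𝓝 θ] fun _ => 0 := by
      have : ContinuousAt (fun θ : ℝ => |θ|) θ := by fun_prop
      filter_upwards [this.eventually (gt_mem_nhds hθ)] with θ' hθ'
      exact (hY (a (θ', z)) (hRz θ' hθ') hεz).1
    -- Implicit differentiation in `θ`: `Y' D = 2 σ η`, where `D` is the `y`-derivative of the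
    -- equation and `ν = 1 / D`.
    have hE1 := hE.unique ((hasDerivAt_const θ (0 : ℝ)).congr_of_eventuallyEq hE0)
    have h2 := powDivDiff_add k z.1 (Y (a (θ, z)))
    have hη : HasDerivAt (fun θ => z.2 - s * (θ * σ z) * powDivDiff k z.1 (Y (a (θ, z))))
        _ θ := ((ha'.const_mul s).mul hP1).const_sub z.2
    have hD1 : D (θ, z) = 1 + s * (θ * σ z) ^ 2 * powDivDiffDeriv k z.1 (Y (a (θ, z))) := rfl
    have e1 : Y' * D (θ, z) = 2 * σ z *
        (z.2 - s * (θ * σ z) * powDivDiff k z.1 (Y (a (θ, z)))) := by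
      rw [hD1]
      simp only [Pi.pow_apply, Nat.cast_ofNat, Nat.add_one_sub_one, pow_one] at hE1
      linear_combination hE1
    convert! hY1.prodMk hη using 1
    have hsol : ∀ {u v : ℝ}, u * D (θ, z) = σ z * v → σ z * (D (θ, z))⁻¹ * v = u := by
      intro u v h
      field_simp
      linear_combination -h
    simp only [Q, Prod.smul_mk, smul_eq_mul]
    simp only [familyEqn] at h0
    refine Prod.ext (hsol ?_) (hsol ?_)
    · linear_combination e1
    · simp only [a] at *
      linear_combination (-(s * (θ * σ z) * powDivDiffDeriv k z.1 (Y (θ * σ z, z)))) * e1 -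
        s * σ z * powDivDiff k z.1 (Y (θ * σ z, z)) * hD1 - s * σ z * h2 +
        s * σ z * powDivDiffDeriv k z.1 (Y (θ * σ z, z)) * h0

end ImplicitFamily

/-! ### Symplecticity and the time function. -/

section Jacobian

variable {r : WithTop ℕ∞} {s : ℝ} {k : ℕ}

/-- The vector field `H_ξ ∂_x - H_x ∂_ξ`. -/
def hamField (s : ℝ) (k : ℕ) (z : ℝ × ℝ) : ℝ × ℝ := (2 * z.2, -(s * (k * z.1 ^ (k - 1))))

theorem hasFDerivAt_hamField (z : ℝ × ℝ) : HasFDerivAt (hamField s k)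
    (((2 : ℝ) • ContinuousLinearMap.snd ℝ ℝ ℝ).prod
      (-((s * (k * ((k - 1 : ℕ) * z.1 ^ (k - 1 - 1)))) • ContinuousLinearMap.fst ℝ ℝ ℝ))) z := by
  have h1 : HasFDerivAt (fun z : ℝ × ℝ => s * (k * z.1 ^ (k - 1)))
      ((s * (k * ((k - 1 : ℕ) * z.1 ^ (k - 1 - 1)))) • ContinuousLinearMap.fst ℝ ℝ ℝ) z := by
    have := (((hasFDerivAt_fst (𝕜 := ℝ) (p := z)).pow (k - 1)).const_mul (k : ℝ)).const_mul s
    convert! this using 1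
    ext <;> simp
  exact ((hasFDerivAt_snd (𝕜 := ℝ) (p := z)).const_mul 2).prodMk h1.neg

/-- The determinant of a linear map of the plane. -/
def jac (A : ℝ × ℝ →L[ℝ] ℝ × ℝ) : ℝ := (A (1, 0)).1 * (A (0, 1)).2 - (A (0, 1)).1 * (A (1, 0)).2

/-- The derivative of `Q_θ^* (f dx ∧ dξ)` along a family of maps `Q_θ` that preserve `H` and move
along `μ (H_ξ ∂_x - H_x ∂_ξ)` is `d(μ f(Q_θ)) ∧ dH`. -/
theorem hasDerivAt_pullback_density {Q : ℝ × (ℝ × ℝ) → ℝ × ℝ} {μ : ℝ × (ℝ × ℝ) → ℝ}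
    {f : ℝ × ℝ → ℝ} {θ : ℝ} {z : ℝ × ℝ} (hQ : ContDiffAt ℝ 2 Q (θ, z))
    (hμ : DifferentiableAt ℝ μ (θ, z)) (hf : DifferentiableAt ℝ f (Q (θ, z)))
    (hQθ : ∀ᶠ p in 𝓝 (θ, z), fderiv ℝ Q p (1, 0) = μ p • hamField s k (Q p))
    (hQH : ∀ᶠ p in 𝓝 (θ, z), ham s k (Q p) = ham s k p.2) :
    HasDerivAt (fun θ => f (Q (θ, z)) *
        jac ((fderiv ℝ Q (θ, z)).comp (ContinuousLinearMap.inr ℝ ℝ (ℝ × ℝ))))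
      (fderiv ℝ (fun p => μ p * f (Q p)) (θ, z) (0, (1, 0)) * (2 * z.2) -
        fderiv ℝ (fun p => μ p * f (Q p)) (θ, z) (0, (0, 1)) * (s * (k * z.1 ^ (k - 1)))) θ := by
  have hQd := (hQ.differentiableAt (by simp)).hasFDerivAt
  have hQ2 : DifferentiableAt ℝ (fderiv ℝ Q) (θ, z) :=
    (hQ.fderiv_right (m := 1) (by norm_num)).differentiableAt (by simp)
  have hsym := hQ.isSymmSndFDerivAt (by simp)
  have hline : HasDerivAt (fun θ : ℝ => (θ, z)) ((1 : ℝ), (0 : ℝ × ℝ)) θ :=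
    (hasDerivAt_id θ).prodMk (hasDerivAt_const θ z)
  -- the derivative of the spatial derivatives along the family
  have hS : ∀ v, fderiv ℝ (fderiv ℝ Q) (θ, z) (1, 0) v =
      fderiv ℝ μ (θ, z) v • hamField s k (Q (θ, z)) + μ (θ, z) •
        ((2 * (fderiv ℝ Q (θ, z) v).2, -(s * (k * ((k - 1 : ℕ) *
          (Q (θ, z)).1 ^ (k - 1 - 1))) * (fderiv ℝ Q (θ, z) v).1)) : ℝ × ℝ) := by
    intro v
    -- Interchanging the mixed derivatives turns the `θ`-derivative of the Jacobian matrix into a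
    -- spatial derivative of the velocity.
    rw [hsym.eq]
    have h1 : HasFDerivAt (fun p => fderiv ℝ Q p (1, 0)) _ (θ, z) :=
      hQ2.hasFDerivAt.clm_apply (hasFDerivAt_const ((1 : ℝ), (0 : ℝ × ℝ)) (θ, z))
    have h2 : HasFDerivAt (fun p => μ p • hamField s k (Q p)) _ (θ, z) :=
      hμ.hasFDerivAt.smul ((hasFDerivAt_hamField (Q (θ, z))).comp (θ, z) hQd)
    have h3 := h1.unique (h2.congr_of_eventuallyEq hQθ)
    have h4 := congrArg (fun L : ℝ × (ℝ × ℝ) →L[ℝ] ℝ × ℝ => L v) h3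
    simpa [add_comm] using h4
  have hA : ∀ v, HasDerivAt (fun θ => fderiv ℝ Q (θ, z) v)
      (fderiv ℝ (fderiv ℝ Q) (θ, z) (1, 0) v) θ := by
    intro v
    have h1 : HasDerivAt (fun θ => fderiv ℝ Q (θ, z)) _ θ :=
      HasFDerivAt.comp_hasDerivAt (f := fun θ : ℝ => (θ, z)) θ hQ2.hasFDerivAt hline
    simpa using h1.clm_apply (hasDerivAt_const θ v)
  have hA1 : ∀ v, HasDerivAt (fun θ => (fderiv ℝ Q (θ, z) v).1)
      (fderiv ℝ (fderiv ℝ Q) (θ, z) (1, 0) v).1 θ := fun v => by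
    have h := (ContinuousLinearMap.fst ℝ ℝ ℝ).hasFDerivAt.comp_hasDerivAt θ (hA v)
    exact h
  have hA2 : ∀ v, HasDerivAt (fun θ => (fderiv ℝ Q (θ, z) v).2)
      (fderiv ℝ (fderiv ℝ Q) (θ, z) (1, 0) v).2 θ := fun v => by
    have h := (ContinuousLinearMap.snd ℝ ℝ ℝ).hasFDerivAt.comp_hasDerivAt θ (hA v)
    exact h
  have hfQ : HasFDerivAt (fun p => f (Q p)) ((fderiv ℝ f (Q (θ, z))).comp (fderiv ℝ Q (θ, z)))
      (θ, z) := hf.hasFDerivAt.comp (θ, z) hQd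
  have hfθ : HasDerivAt (fun θ => f (Q (θ, z)))
      (fderiv ℝ f (Q (θ, z)) (fderiv ℝ Q (θ, z) (1, 0))) θ :=
    HasFDerivAt.comp_hasDerivAt (f := fun θ : ℝ => (θ, z)) θ hfQ hline
  have hJ := hfθ.mul (((hA1 (0, (1, 0))).mul (hA2 (0, (0, 1)))).sub
    ((hA1 (0, (0, 1))).mul (hA2 (0, (1, 0)))))
  have hm : ∀ v, fderiv ℝ (fun p => μ p * f (Q p)) (θ, z) v =
      fderiv ℝ μ (θ, z) v * f (Q (θ, z)) +
        μ (θ, z) * fderiv ℝ f (Q (θ, z)) (fderiv ℝ Q (θ, z) v) := by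
    intro v
    have h : HasFDerivAt (fun p => μ p * f (Q p)) _ (θ, z) := hμ.hasFDerivAt.mul hfQ
    rw [h.fderiv]
    simp only [add_apply, smul_apply, smul_eq_mul, ContinuousLinearMap.comp_apply]
    ring
  have hH : ∀ v : ℝ × ℝ, dham s k (Q (θ, z)) (fderiv ℝ Q (θ, z) (0, v)) = dham s k z v := by
    intro v
    have h1 : HasFDerivAt (fun p => ham s k (Q p)) _ (θ, z) :=
      (hasFDerivAt_ham s k (Q (θ, z))).comp (θ, z) hQd
    have h2 : HasFDerivAt (fun p : ℝ × (ℝ × ℝ) => ham s k p.2) _ (θ, z) :=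
      HasFDerivAt.comp (f := fun p : ℝ × (ℝ × ℝ) => p.2) (θ, z)
        (hasFDerivAt_ham s k z) hasFDerivAt_snd
    have h3 := h1.unique (h2.congr_of_eventuallyEq hQH)
    exact congrArg (fun L : ℝ × (ℝ × ℝ) →L[ℝ] ℝ => L (0, v)) h3
  have hfv : ∀ v : ℝ × ℝ, fderiv ℝ f (Q (θ, z)) v =
      v.1 * fderiv ℝ f (Q (θ, z)) (1, 0) + v.2 * fderiv ℝ f (Q (θ, z)) (0, 1) := by
    intro v
    conv_lhs => rw [show v = v.1 • ((1 : ℝ), (0 : ℝ)) + v.2 • ((0 : ℝ), (1 : ℝ)) by ext <;> simp]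
    rw [map_add, map_smul, map_smul, smul_eq_mul, smul_eq_mul]
  have e1 := hH (1, 0)
  have e2 := hH (0, 1)
  simp only [dham_apply, mul_one, mul_zero, add_zero, zero_add] at e1 e2
  convert! hJ using 1
  rw [hm, hm, hS, hS, hQθ.self_of_nhds, hfv (fderiv ℝ Q (θ, z) (0, (1, 0))),
    hfv (fderiv ℝ Q (θ, z) (0, (0, 1))), hfv (μ (θ, z) • _)]
  simp only [hamField, Prod.smul_mk, smul_eq_mul, Prod.mk_add_mk, Pi.mul_apply, Pi.sub_apply]
  generalize (fderiv ℝ Q (θ, z) (0, (1, 0))).1 = yx at *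
  generalize (fderiv ℝ Q (θ, z) (0, (1, 0))).2 = ηx at *
  generalize (fderiv ℝ Q (θ, z) (0, (0, 1))).1 = yξ at *
  generalize (fderiv ℝ Q (θ, z) (0, (0, 1))).2 = ηξ at *
  generalize fderiv ℝ μ (θ, z) (0, (1, 0)) = μx at *
  generalize fderiv ℝ μ (θ, z) (0, (0, 1)) = μξ at *
  generalize fderiv ℝ f (Q (θ, z)) (1, 0) = fx at *
  generalize fderiv ℝ f (Q (θ, z)) (0, 1) = fξ at *
  generalize μ (θ, z) = m at *
  -- The components of `dH` at `z` are replaced by those of its pull-back from `Q_θ(z)`; a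
  -- polynomial identity remains.
  rw [← e1, ← e2]
  ring

theorem eventually_forall_family_mem {Q : ℝ × (ℝ × ℝ) → ℝ × ℝ} {N : Set (ℝ × ℝ)} (hN : N ∈ 𝓝 0)
    (hQ : ∀ θ ∈ Icc (0 : ℝ) 1, ContinuousAt Q (θ, 0) ∧ Q (θ, 0) = 0) :
    ∀ᶠ z in 𝓝 (0 : ℝ × ℝ), ∀ θ ∈ Icc (0 : ℝ) 1, Q (θ, z) ∈ N := by
  have : ∀ᶠ z in 𝓝 (0 : ℝ × ℝ), ∀ t ∈ Icc (0 : ℝ) 1, Q (z, t).swap ∈ N := by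
    refine isCompact_Icc.eventually_forall_of_forall_eventually fun t ht => ?_
    have h2 : Tendsto (Prod.swap : (ℝ × ℝ) × ℝ → ℝ × (ℝ × ℝ)) (𝓝 (0, t)) (𝓝 (t, 0)) :=
      continuous_swap.tendsto _
    have h3 := (hQ t ht).1.tendsto
    rw [(hQ t ht).2] at h3
    exact (h3.comp h2).eventually hN
  simpa using this

/-- The time function of a symplectic map that is joined to the identity as in `exists_family` is
a first integral of `H`. -/
theorem exists_isFirstIntegralOn_time (hr : r = ∞ ∨ r = ω) {φ : ℝ × ℝ → ℝ × ℝ} {f : ℝ × ℝ → ℝ}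
    (hf : ∀ᶠ z in 𝓝 0, ContDiffAt ℝ r f z)
    (hφf : ∀ᶠ z in 𝓝 (0 : ℝ × ℝ), f (φ z) * jac (fderiv ℝ φ z) = f z)
    {Q : ℝ × (ℝ × ℝ) → ℝ × ℝ} {μ : ℝ × (ℝ × ℝ) → ℝ}
    (hQ : ∀ᶠ z in 𝓝 (0 : ℝ × ℝ), Q (0, z) = z ∧ Q (1, z) = φ z ∧ ∀ θ : ℝ, |θ| < 2 → Q (θ, 0) = 0 ∧
        ContDiffAt ℝ r Q (θ, z) ∧ ContDiffAt ℝ r μ (θ, z) ∧ ham s k (Q (θ, z)) = ham s k z ∧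
        HasDerivAt (fun θ => Q (θ, z)) (μ (θ, z) • hamField s k (Q (θ, z))) θ) :
    ∃ ε > 0, IsFirstIntegralOn r s k (fun z => ∫ θ in (0 : ℝ)..1, μ (θ, z) * f (Q (θ, z)))
      (Metric.ball 0 ε) := by
  have hr0 := ne_zero_of_infty_or_omega hr
  have hr1 := one_le_of_infty_or_omega hr
  have hr2 : (2 : WithTop ℕ∞) ≤ r := by
    have := add_one_le_of_infty_or_omega hr
    calc (2 : WithTop ℕ∞) = 1 + 1 := by norm_num
      _ ≤ r + 1 := by gcongr
      _ ≤ r := this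
  have hI : ∀ θ ∈ Icc (0 : ℝ) 1, |θ| < 2 := fun θ hθ => by
    rw [abs_of_nonneg hθ.1]; linarith [hθ.2]
  have hfQ := eventually_forall_family_mem hf fun θ hθ =>
    ⟨(hQ.self_of_nhds.2.2 θ (hI θ hθ)).2.1.continuousAt, (hQ.self_of_nhds.2.2 θ (hI θ hθ)).1⟩
  obtain ⟨ε, hε, hball⟩ := Metric.eventually_nhds_iff_ball.1 ((hQ.and hφf).and hfQ)
  refine ⟨ε, hε, fun z hz => ?_⟩
  obtain ⟨⟨⟨-, -, hQz⟩, hφz⟩, hfz⟩ := hball z hz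
  have hzn := Metric.isOpen_ball.mem_nhds hz
  have hm : ∀ θ ∈ Icc (0 : ℝ) 1, ContDiffAt ℝ r (fun p => μ p * f (Q p)) (θ, z) := fun θ hθ =>
    (hQz θ (hI θ hθ)).2.2.1.mul
      (ContDiffAt.comp (θ, z) (hfz θ hθ) (hQz θ (hI θ hθ)).2.1)
  refine ⟨contDiffAt_integral_zero_one hr hm, ?_⟩
  have hτ := hasFDerivAt_integral_zero_one fun θ hθ => (hm θ hθ).of_le hr1
  have hmc : ContinuousOn (fun θ => (fderiv ℝ (fun p => μ p * f (Q p)) (θ, z)).comp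
      (ContinuousLinearMap.inr ℝ ℝ (ℝ × ℝ))) (uIcc (0 : ℝ) 1) := by
    intro θ hθ
    rw [uIcc_of_le zero_le_one] at hθ
    have h1 := (((hm θ hθ).of_le hr1).fderiv_right (m := 0) (by simp)).continuousAt
    exact ((h1.comp (f := fun θ : ℝ => (θ, z)) (by fun_prop)).clm_comp
      continuousAt_const).continuousWithinAt
  have hmv : ∀ v, IntervalIntegrable (fun θ => fderiv ℝ (fun p => μ p * f (Q p)) (θ, z) (0, v))
      MeasureTheory.volume 0 1 := fun v =>
    (hmc.clm_apply (continuousOn_const (c := v))).intervalIntegrable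
  rw [hτ.fderiv, ContinuousLinearMap.intervalIntegral_apply hmc.intervalIntegrable,
    ContinuousLinearMap.intervalIntegral_apply hmc.intervalIntegrable]
  simp only [ContinuousLinearMap.comp_apply, ContinuousLinearMap.inr_apply]
  rw [← intervalIntegral.integral_mul_const, ← intervalIntegral.integral_mul_const, ← sub_eq_zero,
    ← intervalIntegral.integral_sub ((hmv _).mul_const _) ((hmv _).mul_const _)]
  have hnear : ∀ θ : ℝ, |θ| < 2 → ∀ᶠ p in 𝓝 (θ, z), |p.1| < 2 ∧ p.2 ∈ Metric.ball (0 : ℝ × ℝ) ε :=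
    fun θ hθ => by
      have h1 : ContinuousAt (fun p : ℝ × (ℝ × ℝ) => |p.1|) (θ, z) := by fun_prop
      exact (h1.eventually (gt_mem_nhds hθ)).and (continuousAt_snd.eventually hzn)
  have hder : ∀ θ ∈ uIcc (0 : ℝ) 1, HasDerivAt (fun θ => f (Q (θ, z)) *
      jac ((fderiv ℝ Q (θ, z)).comp (ContinuousLinearMap.inr ℝ ℝ (ℝ × ℝ)))) _ θ := fun θ hθ => by
    rw [uIcc_of_le zero_le_one] at hθ
    obtain ⟨-, h1, h2, -, -⟩ := hQz θ (hI θ hθ)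
    refine hasDerivAt_pullback_density (s := s) (k := k) (μ := μ) (h1.of_le hr2)
      (h2.differentiableAt hr0) ((hfz θ hθ : ContDiffAt ℝ r f _).differentiableAt hr0) ?_ ?_
    · filter_upwards [hnear θ (hI θ hθ)] with p hp
      obtain ⟨-, h3, -, -, h4⟩ := (hball p.2 hp.2).1.1.2.2 p.1 hp.1
      have h5 : HasDerivAt (fun θ => Q (θ, p.2)) (fderiv ℝ Q (p.1, p.2) (1, 0)) p.1 :=
        HasFDerivAt.comp_hasDerivAt (f := fun θ : ℝ => (θ, p.2)) p.1
          (h3.differentiableAt hr0).hasFDerivAt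
          ((hasDerivAt_id p.1).prodMk (hasDerivAt_const p.1 p.2))
      exact h5.unique h4
    · filter_upwards [hnear θ (hI θ hθ)] with p hp
      exact ((hball p.2 hp.2).1.1.2.2 p.1 hp.1).2.2.2.1
  -- The integral of `d/dθ Q_θ^* ω` is the density of `φ^* ω - ω`, that is zero.
  rw [intervalIntegral.integral_eq_sub_of_hasDerivAt hder
    (((hmv _).mul_const _).sub ((hmv _).mul_const _))]
  have hslice : ∀ θ : ℝ, |θ| < 2 → ∀ ψ : ℝ × ℝ → ℝ × ℝ, (∀ w ∈ Metric.ball (0 : ℝ × ℝ) ε,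
      Q (θ, w) = ψ w) → (fderiv ℝ Q (θ, z)).comp (ContinuousLinearMap.inr ℝ ℝ (ℝ × ℝ)) =
        fderiv ℝ ψ z := by
    intro θ hθ ψ hψ
    have h1 : HasFDerivAt (fun w => Q (θ, w)) _ z :=
      ((hQz θ hθ).2.1.differentiableAt hr0).hasFDerivAt.comp z (hasFDerivAt_prodMk_right θ z)
    refine (h1.congr_of_eventuallyEq ?_).fderiv.symm
    filter_upwards [hzn] with w hw using (hψ w hw).symm
  rw [hslice 1 (by norm_num) φ fun w hw => (hball w hw).1.1.2.1,
    hslice 0 (by norm_num) id fun w hw => (hball w hw).1.1.1,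
    (hball z hz).1.1.1, (hball z hz).1.1.2.1, hφz, fderiv_id]
  simp [jac]

end Jacobian

/-! ### Reparametrization and time-one maps. -/

section TimeOneMaps

variable {r : WithTop ℕ∞} {s : ℝ} {k : ℕ}

/-- A positive density on `[0, 1]` is made constant by a change of the variable. -/
theorem exists_reparametrization_of_pos {m : ℝ → ℝ} (hm : ContinuousOn m (Icc 0 1))
    (hpos : ∀ t ∈ Icc (0 : ℝ) 1, 0 < m t) :
    ∃ θ : ℝ → ℝ, θ 0 = 0 ∧ θ 1 = 1 ∧ ∀ t ∈ Icc (0 : ℝ) 1, θ t ∈ Icc (0 : ℝ) 1 ∧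
      HasDerivAt θ ((∫ t in (0 : ℝ)..1, m t) / m (θ t)) t := by
  -- Constant extension beyond `[0, 1]` keeps a positive lower bound, so that the primitive `M` is a
  -- bijection of the line; the new variable is `M⁻¹(t M(1))`.
  set n : ℝ → ℝ := IccExtend zero_le_one ((Icc (0 : ℝ) 1).domRestrict m) with hn
  have hnc : Continuous n := (continuousOn_iff_continuous_domRestrict.1 hm).Icc_extend'
  have hnm : ∀ t ∈ Icc (0 : ℝ) 1, n t = m t := fun t ht => IccExtend_of_mem _ _ ht
  obtain ⟨t₀, ht₀, hmin⟩ := isCompact_Icc.exists_isMinOn (nonempty_Icc.2 zero_le_one) hm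
  set c := m t₀ with hc
  have hc0 : 0 < c := hpos t₀ ht₀
  have hnc' : ∀ t, c ≤ n t := fun t => hmin (projIcc 0 1 zero_le_one t).2
  set M : ℝ → ℝ := fun x => ∫ t in (0 : ℝ)..x, n t with hM
  have hMd : ∀ x, HasDerivAt M (n x) x := fun x =>
    intervalIntegral.integral_hasDerivAt_right (hnc.intervalIntegrable _ _)
      hnc.stronglyMeasurable.stronglyMeasurableAtFilter hnc.continuousAt
  have hM0 : M 0 = 0 := intervalIntegral.integral_same
  have hmono : StrictMono M := strictMono_of_deriv_pos fun x => by
    rw [(hMd x).deriv]; exact hc0.trans_le (hnc' x)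
  have hmono' : Monotone fun x => M x - c * x := by
    have hd : ∀ x, HasDerivAt (fun x => M x - c * x) (n x - c * 1) x := fun x =>
      (hMd x).sub ((hasDerivAt_id x).const_mul c)
    refine monotone_of_deriv_nonneg (fun x => (hd x).differentiableAt) fun x => ?_
    rw [(hd x).deriv]
    linarith [hnc' x]
  have hMc : Continuous M := continuous_iff_continuousAt.2 fun x => (hMd x).continuousAt
  have hsurj : Function.Surjective M := by
    refine hMc.surjective ?_ ?_
    · refine tendsto_atTop_mono' _ ?_ (tendsto_id.const_mul_atTop hc0)
      filter_upwards [eventually_ge_atTop 0] with x hx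
      have := hmono' hx
      simp only [hM0, mul_zero, sub_zero] at this
      simp only [id]; linarith
    · refine tendsto_atBot_mono' _ ?_ (tendsto_id.const_mul_atBot hc0)
      filter_upwards [eventually_le_atBot 0] with x hx
      have := hmono' hx
      simp only [hM0, mul_zero, sub_zero] at this
      simp only [id]; linarith
  let e := hmono.orderIsoOfSurjective M hsurj
  have he : ∀ y, M (e.symm y) = y := fun y => e.apply_symm_apply y
  have he' : ∀ x, e.symm (M x) = x := fun x => e.symm_apply_apply x
  have hM1 : M 1 = ∫ t in (0 : ℝ)..1, m t :=
    intervalIntegral.integral_congr fun t ht => hnm t (by rwa [uIcc_of_le zero_le_one] at ht)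
  have hM1p : 0 ≤ M 1 := hM0 ▸ hmono.monotone zero_le_one
  refine ⟨fun t => e.symm (t * M 1), ?_, ?_, fun t ht => ?_⟩
  · have h := he' 0
    rw [hM0] at h
    simpa only [zero_mul] using h
  · simpa only [one_mul] using he' 1
  have hmem : e.symm (t * M 1) ∈ Icc (0 : ℝ) 1 := by
    constructor
    · rw [← he' 0, hM0]
      exact e.symm.monotone (mul_nonneg ht.1 hM1p)
    · rw [← he' 1]
      exact e.symm.monotone (by rw [he']; exact mul_le_of_le_one_left hM1p ht.2)
  refine ⟨hmem, ?_⟩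
  have hinv : HasDerivAt e.symm (n (e.symm (t * M 1)))⁻¹ (t * M 1) :=
    (hMd _).of_local_left_inverse e.symm.continuous.continuousAt
      (hc0.trans_le (hnc' _)).ne' (Eventually.of_forall he)
  have h1 := hinv.comp t ((hasDerivAt_id t).mul_const (M 1))
  rw [hnm _ hmem] at h1
  rw [← hM1]
  convert! h1 using 1
  ring

/-- The quotient is unchanged by a constant factor, so a density of either sign is allowed; the sign
will be that of `ω` at the origin. -/
theorem exists_reparametrization {m : ℝ → ℝ} (c : ℝ) (hm : ContinuousOn m (Icc 0 1))
    (hpos : ∀ t ∈ Icc (0 : ℝ) 1, 0 < c * m t) :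
    ∃ θ : ℝ → ℝ, θ 0 = 0 ∧ θ 1 = 1 ∧ ∀ t ∈ Icc (0 : ℝ) 1, θ t ∈ Icc (0 : ℝ) 1 ∧
      HasDerivAt θ ((∫ t in (0 : ℝ)..1, m t) / m (θ t)) t := by
  obtain ⟨θ, h0, h1, h⟩ := exists_reparametrization_of_pos (m := fun t => c * m t)
    (continuousOn_const.mul hm) hpos
  refine ⟨θ, h0, h1, fun t ht => ⟨(h t ht).1, ?_⟩⟩
  have hc : c ≠ 0 := fun hc => by simpa [hc] using hpos 0 ⟨le_rfl, zero_le_one⟩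
  have := (h t ht).2
  rwa [intervalIntegral.integral_const_mul, mul_div_mul_left _ _ hc] at this

/-- The density of a 2-form with respect to `dx ∧ dξ`. -/
def density (Ω : TwoForm) (z : ℝ × ℝ) : ℝ := Ω z ![(1, 0), (0, 1)]

theorem twoForm_apply (Ω : TwoForm) (z v w : ℝ × ℝ) :
    Ω z ![v, w] = density Ω z * (v.1 * w.2 - v.2 * w.1) := by
  have hadd : ∀ a b c : ℝ × ℝ, Ω z ![a + b, c] = Ω z ![a, c] + Ω z ![b, c] := fun a b c =>
    (Ω z).map_vecCons_add _ _ _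
  have hsmul : ∀ (t : ℝ) (a b : ℝ × ℝ), Ω z ![t • a, b] = t * Ω z ![a, b] := fun t a b =>
    (Ω z).map_vecCons_smul _ _ _
  have hself : ∀ a : ℝ × ℝ, Ω z ![a, a] = 0 := fun a =>
    (Ω z).map_eq_zero_of_eq ![a, a] (i := 0) (j := 1) rfl (by decide)
  have hswap : ∀ a b : ℝ × ℝ, Ω z ![a, b] = -Ω z ![b, a] := by
    intro a b
    have h := (Ω z).toAlternatingMap.map_swap ![b, a] (i := 0) (j := 1) (by decide)
    have e : ![b, a] ∘ Equiv.swap (0 : Fin 2) 1 = ![a, b] := by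
      ext i <;> fin_cases i <;> simp
    rw [e] at h
    exact h
  have hdec : ∀ a : ℝ × ℝ, a = a.1 • ((1 : ℝ), (0 : ℝ)) + a.2 • ((0 : ℝ), (1 : ℝ)) := fun a => by
    ext <;> simp
  have h1 : ∀ b : ℝ × ℝ, Ω z ![(1, 0), b] = b.2 * density Ω z := fun b => by
    rw [hswap, hdec b, hadd, hsmul, hsmul, hself, hswap (0, 1)]
    simp [density]
  have h2 : ∀ b : ℝ × ℝ, Ω z ![(0, 1), b] = -(b.1 * density Ω z) := fun b => by
    rw [hswap, hdec b, hadd, hsmul, hsmul, hself]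
    simp [density]
  rw [hdec v, hadd, hsmul, hsmul, h1, h2]
  simp
  ring

theorem density_pullback (φ : ℝ × ℝ → ℝ × ℝ) (Ω : TwoForm) (z : ℝ × ℝ) :
    density (pullback φ Ω) z = density Ω (φ z) * jac (fderiv ℝ φ z) := by
  have h : density (pullback φ Ω) z =
      Ω (φ z) ![fderiv ℝ φ z (1, 0), fderiv ℝ φ z (0, 1)] := by
    unfold density pullback
    rw [ContinuousAlternatingMap.compContinuousLinearMap_apply]
    congr 1
    ext i <;> fin_cases i <;> simp
  rw [h, twoForm_apply, jac]
  ring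

theorem contDiffAt_density {Ω : TwoForm} {z : ℝ × ℝ} (h : ContDiffAt ℝ r Ω z) :
    ContDiffAt ℝ r (density Ω) z :=
  (ContinuousAlternatingMap.apply ℝ (ℝ × ℝ) ℝ
    ![((1 : ℝ), (0 : ℝ)), (0, 1)]).contDiff.contDiffAt.comp z h

theorem IsSymplecticOn.density_ne_zero {Ω : TwoForm} {V : Set (ℝ × ℝ)} (h : IsSymplecticOn r Ω V)
    {z : ℝ × ℝ} (hz : z ∈ V) : density Ω z ≠ 0 := by
  intro h0
  have := h.2.2 z hz (1, 0) fun w => by rw [twoForm_apply, h0, zero_mul]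
  simpa using congrArg Prod.fst this

theorem IsSymplecticOn.mono {Ω : TwoForm} {V W : Set (ℝ × ℝ)} (h : IsSymplecticOn r Ω W)
    (hV : V ⊆ W) : IsSymplecticOn r Ω V :=
  ⟨h.1.mono hV, fun z hz => h.2.1 z (hV hz), fun z hz => h.2.2 z (hV hz)⟩

/-- A symplectic map that preserves `H` and whose differential at the origin has a positive upper
left entry is the time-one map of the flow of a function whose differential is proportional to
`dH`. -/
theorem exists_generator (hr : r = ∞ ∨ r = ω) (hs : s = 1 ∨ s = -1) (hk : 2 < k)
    {Ω : TwoForm} {W : Set (ℝ × ℝ)} (hW : IsOpen W) (hW0 : 0 ∈ W) (hΩ : IsSymplecticOn r Ω W)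
    {φ : ℝ × ℝ → ℝ × ℝ} (hφ : ∀ᶠ z in 𝓝 (0 : ℝ × ℝ), ContDiffAt ℝ r φ z) (hφ0 : φ 0 = 0)
    (hφΩ : ∀ᶠ z in 𝓝 (0 : ℝ × ℝ), pullback φ Ω z = Ω z)
    (hφH : ∀ᶠ z in 𝓝 (0 : ℝ × ℝ), ham s k (φ z) = ham s k z)
    (ha : 0 < (fderiv ℝ φ 0 (1, 0)).1) :
    ∃ ρ > 0, Metric.ball (0 : ℝ × ℝ) ρ ⊆ W ∧ ∃ g τ : ℝ × ℝ → ℝ, ContDiffAt ℝ r τ 0 ∧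
      (∀ z ∈ Metric.ball (0 : ℝ × ℝ) ρ, ContDiffAt ℝ r g z ∧ HasFDerivAt g (τ z • dham s k z) z) ∧
      ∀ V ⊆ Metric.ball (0 : ℝ × ℝ) ρ, V ∈ 𝓝 0 → IsTimeOneMap Ω g V φ := by
  have hr0 := ne_zero_of_infty_or_omega hr
  have hr1 := one_le_of_infty_or_omega hr
  have hs0 : s ≠ 0 := by rcases hs with rfl | rfl <;> norm_num
  set f := density Ω with hf
  have hfc : ∀ᶠ z in 𝓝 (0 : ℝ × ℝ), ContDiffAt ℝ r f z := by
    filter_upwards [hW.mem_nhds hW0] with z hz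
    exact contDiffAt_density (hΩ.1.contDiffAt (hW.mem_nhds hz))
  have hf0 : f 0 ≠ 0 := hΩ.density_ne_zero hW0
  have hφf : ∀ᶠ z in 𝓝 (0 : ℝ × ℝ), f (φ z) * jac (fderiv ℝ φ z) = f z := by
    filter_upwards [hφΩ] with z hz
    rw [hf, ← density_pullback, density, hz, density]
  have hφd := hφ.self_of_nhds.differentiableAt hr0
  have hc := fderiv_snd_eq_zero_of_ham_comp hk hφd hφ0 hφH
  -- Preservation of `ω` at the fixed point `0` makes the determinant of the triangular matrix
  -- `dφ(0)` equal to 1.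
  have hd : 0 < (fderiv ℝ φ 0 (0, 1)).2 := by
    have h1 := hφf.self_of_nhds
    rw [hφ0, jac, hc, mul_zero, sub_zero] at h1
    have h2 : (fderiv ℝ φ 0 (1, 0)).1 * (fderiv ℝ φ 0 (0, 1)).2 = 1 :=
      mul_left_cancel₀ hf0 (by rw [h1, mul_one])
    exact pos_of_mul_pos_right (by rw [h2]; exact one_pos) ha.le
  obtain ⟨σ, hσ, hσφ⟩ := exists_factor hr hs0 hk hφ hφ0 hφH ha hc hd
  obtain ⟨Q, ν, hQ⟩ := exists_family hr hs hk hφ.self_of_nhds.continuousAt hφ0 hσ hσφ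
  have hI : ∀ θ ∈ Icc (0 : ℝ) 1, |θ| < 2 := fun θ hθ => by
    rw [abs_of_nonneg hθ.1]; linarith [hθ.2]
  obtain ⟨ε, hε, hτ⟩ := exists_isFirstIntegralOn_time (s := s) (k := k) hr hfc hφf (Q := Q)
    (μ := fun p => σ p.2 * ν p) (by
      filter_upwards [hQ, hσ] with z hz hσz
      refine ⟨hz.1, hz.2.1, fun θ hθ => ?_⟩
      obtain ⟨h1, h2, h3, -, h4, h5⟩ := hz.2.2 θ hθ
      exact ⟨h1, h2, (ContDiffAt.comp (θ, z) hσz contDiffAt_snd).mul h3, h4, h5⟩)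
  set τ : ℝ × ℝ → ℝ := fun z => ∫ θ in (0 : ℝ)..1, σ z * ν (θ, z) * f (Q (θ, z)) with hτdef
  obtain ⟨l, hl, hτl⟩ := hτ.exists_hasFDerivAt hr hs0 hk
  obtain ⟨ρ₁, hρ₁, hρε, hconst⟩ := exists_forall_isPreconnected_eq hε
    ((hl 0 (Metric.mem_ball_self hε)).1.of_le hr1) hτl
  obtain ⟨ρ₂, hρ₂, hρW⟩ := Metric.isOpen_iff.1 hW 0 hW0
  obtain ⟨g, hg⟩ := hτ.exists_primitive hr
  have hsub₁ : Metric.ball (0 : ℝ × ℝ) (min ρ₁ ρ₂) ⊆ Metric.ball 0 ρ₁ :=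
    Metric.ball_subset_ball (min_le_left _ _)
  have hsubε : Metric.ball (0 : ℝ × ℝ) (min ρ₁ ρ₂) ⊆ Metric.ball 0 ε :=
    hsub₁.trans (Metric.ball_subset_ball hρε)
  have hsubW : Metric.ball (0 : ℝ × ℝ) (min ρ₁ ρ₂) ⊆ W :=
    (Metric.ball_subset_ball (min_le_right _ _)).trans hρW
  refine ⟨min ρ₁ ρ₂, lt_min hρ₁ hρ₂, hsubW, g, τ, (hτ 0 (Metric.mem_ball_self hε)).1,
    fun z hz => hg z (hsubε hz), fun V hVρ hV => ?_⟩
  refine ⟨fun z => (τ z / f z) • hamField s k z, fun z hz v => ?_, ?_⟩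
  · have hfz : f z ≠ 0 := hΩ.density_ne_zero (hsubW (hVρ hz))
    rw [(hg z (hsubε (hVρ hz))).2.fderiv, twoForm_apply, smul_apply, dham_apply]
    simp only [hamField, Prod.smul_mk, smul_eq_mul]
    field_simp
    ring
  have hfpos : {w | 0 < f 0 * f w} ∈ 𝓝 (0 : ℝ × ℝ) :=
    (continuousAt_const.mul hfc.self_of_nhds.continuousAt).eventually
      (lt_mem_nhds (mul_self_pos.2 hf0))
  have hmem := eventually_forall_family_mem (inter_mem (inter_mem hV hfpos) hfc) fun θ hθ =>
    ⟨(hQ.self_of_nhds.2.2 θ (hI θ hθ)).2.1.continuousAt, (hQ.self_of_nhds.2.2 θ (hI θ hθ)).1⟩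
  filter_upwards [hQ, hmem] with z ⟨hQ0, hQ1, hQz⟩ hmz
  have hQc : ContinuousOn (fun θ => Q (θ, z)) (Icc 0 1) := fun θ hθ =>
    (hQz θ (hI θ hθ)).2.2.2.2.2.continuousAt.continuousWithinAt
  have hmc : ContinuousOn (fun θ => ν (θ, z) * f (Q (θ, z))) (Icc 0 1) := by
    intro θ hθ
    obtain ⟨-, h1, h2, -⟩ := hQz θ (hI θ hθ)
    have h3 : ContinuousAt (fun p => ν p * f (Q p)) (θ, z) :=
      h2.continuousAt.mul (ContinuousAt.comp
        (hmz θ hθ).2.continuousAt h1.continuousAt)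
    exact (h3.comp (f := fun θ : ℝ => (θ, z)) (by fun_prop)).continuousWithinAt
  -- `σ` depends on `z` alone and may vanish. Only the factor `ν f(Q)`, which has no zeros, enters
  -- the reparametrization, so fixed points need no separate treatment.
  have hτz : τ z = σ z * ∫ θ in (0 : ℝ)..1, ν (θ, z) * f (Q (θ, z)) := by
    rw [hτdef, ← intervalIntegral.integral_const_mul]
    simp only [mul_assoc]
  obtain ⟨θ, hθ0, hθ1, hθ⟩ := exists_reparametrization (f 0) hmc fun t ht => by
    have h1 : 0 < f 0 * f (Q (t, z)) := (hmz t ht).1.2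
    have h2 := (hQz t (hI t ht)).2.2.2.1
    calc 0 < ν (t, z) * (f 0 * f (Q (t, z))) := mul_pos h2 h1
      _ = _ := by ring
  -- The curve is a connected subset of one level set, and `dτ` is a multiple of `dH`.
  have hτc : ∀ t ∈ Icc (0 : ℝ) 1, τ (Q (t, z)) = τ z := by
    intro t ht
    have h := hconst ((fun θ => Q (θ, z)) '' Icc 0 1)
      (by rintro _ ⟨t, ht, rfl⟩; exact hsub₁ (hVρ (hmz t ht).1.1))
      (isPreconnected_Icc.image _ hQc) (ham s k z)
      (by rintro _ ⟨t, ht, rfl⟩; exact (hQz t (hI t ht)).2.2.2.2.1)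
      _ (mem_image_of_mem _ ht) _ (mem_image_of_mem _ (left_mem_Icc.2 zero_le_one))
    simp only [hQ0] at h
    exact h
  refine ⟨fun t => Q (θ t, z), by simp only [hθ0, hQ0], by simp only [hθ1, hQ1], fun t ht => ?_⟩
  obtain ⟨hθt, hθd⟩ := hθ t ht
  refine ⟨(hmz _ hθt).1.1, HasDerivAt.hasDerivWithinAt ?_⟩
  obtain ⟨-, -, -, hνp, -, hQd⟩ := hQz _ (hI _ hθt)
  have h1 := HasDerivAt.scomp (g₁ := fun θ => Q (θ, z)) t hQd hθd
  convert! h1 using 1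
  have hfne : f (Q (θ t, z)) ≠ 0 := by
    have : 0 < f 0 * f (Q (θ t, z)) := (hmz _ hθt).1.2
    exact right_ne_zero_of_mul this.ne'
  -- The new speed is `σ ν (∫ ν f) / (ν f) = τ / f`, as the Hamiltonian field of `g` requires.
  rw [hτc _ hθt, hτz]
  change _ = _ • _ • hamField s k (Q (θ t, z))
  rw [smul_smul]
  congr 1
  have := hνp.ne'
  field_simp

theorem isTimeOneMapOfComponentwiseConst_of_pos (hr : r = ∞ ∨ r = ω) (hs : s = 1 ∨ s = -1)
    (hk : 2 < k) {Ω : TwoForm} {W : Set (ℝ × ℝ)} (hW : IsOpen W) (hW0 : 0 ∈ W)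
    (hΩ : IsSymplecticOn r Ω W) {φ : ℝ × ℝ → ℝ × ℝ}
    (hφ : ∀ᶠ z in 𝓝 (0 : ℝ × ℝ), ContDiffAt ℝ r φ z) (hφ0 : φ 0 = 0)
    (hφΩ : ∀ᶠ z in 𝓝 (0 : ℝ × ℝ), pullback φ Ω z = Ω z)
    (hφH : ∀ᶠ z in 𝓝 (0 : ℝ × ℝ), ham s k (φ z) = ham s k z)
    (ha : 0 < (fderiv ℝ φ 0 (1, 0)).1) :
    IsTimeOneMapOfComponentwiseConst r Ω (ham s k) φ := by
  obtain ⟨ρ, hρ, hρW, g, τ, hτ, hg, hV⟩ := exists_generator hr hs hk hW hW0 hΩ hφ hφ0 hφΩ hφH ha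
  obtain ⟨ρ', hρ', hρρ, hconst⟩ := exists_forall_isPreconnected_eq hρ
    (hτ.of_le (one_le_of_infty_or_omega hr)) fun z hz => (hg z hz).2
  have hsub : Metric.ball (0 : ℝ × ℝ) ρ' ⊆ Metric.ball 0 ρ := Metric.ball_subset_ball hρρ
  refine ⟨Metric.ball 0 ρ', Metric.isOpen_ball, Metric.mem_ball_self hρ',
    hΩ.mono (hsub.trans hρW), g, fun z hz => (hg z (hsub hz)).1.contDiffWithinAt,
    fun p hp q hq => ?_, hV _ hsub (Metric.ball_mem_nhds _ hρ')⟩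
  have hC := connectedComponentIn_subset (Metric.ball 0 ρ' ∩ ham s k ⁻¹' {ham s k p}) p
  exact hconst _ (hC.trans inter_subset_left) isPreconnected_connectedComponentIn (ham s k p)
    (fun z hz => (hC hz).2) q hq p (mem_connectedComponentIn ⟨hp, rfl⟩)

/-- The generator is itself a first integral, hence of the form `G ∘ H` on a smaller neighbourhood.
There both functions have the same differential, so the same vector field serves. -/
theorem isTimeOneMapOfFunctionOf_of_odd (hr : r = ∞ ∨ r = ω) (hs : s = 1 ∨ s = -1)
    (hk : 2 < k) (hodd : Odd k) {Ω : TwoForm} {W : Set (ℝ × ℝ)} (hW : IsOpen W) (hW0 : 0 ∈ W)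
    (hΩ : IsSymplecticOn r Ω W) {φ : ℝ × ℝ → ℝ × ℝ}
    (hφ : ∀ᶠ z in 𝓝 (0 : ℝ × ℝ), ContDiffAt ℝ r φ z) (hφ0 : φ 0 = 0)
    (hφΩ : ∀ᶠ z in 𝓝 (0 : ℝ × ℝ), pullback φ Ω z = Ω z)
    (hφH : ∀ᶠ z in 𝓝 (0 : ℝ × ℝ), ham s k (φ z) = ham s k z)
    (ha : 0 < (fderiv ℝ φ 0 (1, 0)).1) :
    IsTimeOneMapOfFunctionOf r Ω (ham s k) φ := by
  obtain ⟨ρ, hρ, hρW, g, τ, hτ, hg, hV⟩ := exists_generator hr hs hk hW hW0 hΩ hφ hφ0 hφΩ hφH ha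
  have hgI : IsFirstIntegralOn r s k g (Metric.ball 0 ρ) := fun z hz => by
    refine ⟨(hg z hz).1, ?_⟩
    rw [(hg z hz).2.fderiv]
    simp only [smul_apply, dham_apply, smul_eq_mul]
    ring
  obtain ⟨V, J, G, hVo, hV0, hVρ, hJ, hmaps, hG, hgG⟩ := hgI.exists_comp_ham hr hs hodd hk hρ
  refine ⟨V, hVo, hV0, hΩ.mono (hVρ.trans hρW), J, G, hJ, hmaps, hG, ?_⟩
  obtain ⟨X, hX, hflow⟩ := hV V hVρ (hVo.mem_nhds hV0)
  refine ⟨X, fun z hz v => ?_, hflow⟩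
  have he : g =ᶠ[𝓝 z] G ∘ ham s k := eventually_of_mem (hVo.mem_nhds hz) hgG
  rw [hX z hz v, he.fderiv_eq]

/-- A zero entry would make the triangular matrix `dφ(0)` singular, against the preservation of a
non-degenerate form. -/
theorem fderiv_fst_ne_zero (hr : r = ∞ ∨ r = ω) (hk : 2 < k) {Ω : TwoForm}
    (hΩ : density Ω 0 ≠ 0) {φ : ℝ × ℝ → ℝ × ℝ} (hφ : ContDiffAt ℝ r φ 0) (hφ0 : φ 0 = 0)
    (hφΩ : pullback φ Ω 0 = Ω 0)
    (hφH : ∀ᶠ z in 𝓝 (0 : ℝ × ℝ), ham s k (φ z) = ham s k z) :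
    (fderiv ℝ φ 0 (1, 0)).1 ≠ 0 := by
  intro h0
  have hc := fderiv_snd_eq_zero_of_ham_comp hk (hφ.differentiableAt
    (ne_zero_of_infty_or_omega hr)) hφ0 hφH
  have h1 : density (pullback φ Ω) 0 = density Ω 0 := by rw [density, hφΩ, density]
  rw [density_pullback, hφ0, jac, h0, hc] at h1
  simp at h1
  exact hΩ h1.symm

theorem hasFDerivAt_inv (z : ℝ × ℝ) :
    HasFDerivAt inv (-ContinuousLinearMap.id ℝ (ℝ × ℝ)) z :=
  (hasFDerivAt_id z).neg

theorem pullback_comp {φ ψ : ℝ × ℝ → ℝ × ℝ} {z : ℝ × ℝ} (Ω : TwoForm)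
    (hφ : DifferentiableAt ℝ φ (ψ z)) (hψ : DifferentiableAt ℝ ψ z) :
    pullback (φ ∘ ψ) Ω z = pullback ψ (pullback φ Ω) z := by
  unfold pullback
  rw [fderiv_comp z hφ hψ]
  rfl

theorem pullback_congr {φ : ℝ × ℝ → ℝ × ℝ} {Ω Ω' : TwoForm} {z : ℝ × ℝ} (h : Ω (φ z) = Ω' (φ z)) :
    pullback φ Ω z = pullback φ Ω' z := by
  rw [pullback, pullback, h]

end TimeOneMaps

end AkSingularity

/-! ### The theorem: reduction to a positive upper left entry. -/

theorem mainTheorem9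
    -- the category: smooth or real-analytic
    (r : WithTop ℕ∞) (hr : r = ∞ ∨ r = ω)
    (s : ℝ) (hs : s = 1 ∨ s = -1) (k : ℕ) (hk : 2 < k)
    -- a symplectic form near the origin
    (Ω : AkSingularity.TwoForm)
    (hΩ : ∃ W : Set (ℝ × ℝ), IsOpen W ∧ (0 : ℝ × ℝ) ∈ W ∧ AkSingularity.IsSymplecticOn r Ω W)
    -- a map near the origin that fixes the origin and preserves the form and the Hamiltonian;
    -- it is a local diffeomorphism because it preserves the form
    (φ : ℝ × ℝ → ℝ × ℝ)
    (hφ : ∃ U : Set (ℝ × ℝ), IsOpen U ∧ (0 : ℝ × ℝ) ∈ U ∧ ContDiffOn ℝ r φ U)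
    (hφ0 : φ 0 = 0)
    (hφΩ : ∀ᶠ z in 𝓝 (0 : ℝ × ℝ), AkSingularity.pullback φ Ω z = Ω z)
    (hφH : ∀ᶠ z in 𝓝 (0 : ℝ × ℝ), AkSingularity.ham s k (φ z) = AkSingularity.ham s k z) :
    (Odd k → AkSingularity.IsTimeOneMapOfFunctionOf r Ω (AkSingularity.ham s k) φ) ∧
    (Even k →
      ((∀ᶠ z in 𝓝 (0 : ℝ × ℝ), AkSingularity.pullback AkSingularity.inv Ω z = Ω z) →
        AkSingularity.IsTimeOneMapOfComponentwiseConst r Ω (AkSingularity.ham s k) φ ∨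
        AkSingularity.IsTimeOneMapOfComponentwiseConst r Ω (AkSingularity.ham s k)
          (φ ∘ AkSingularity.inv)) ∧
      (0 < (fderiv ℝ φ 0 (1, 0)).1 →
        AkSingularity.IsTimeOneMapOfComponentwiseConst r Ω (AkSingularity.ham s k) φ)) := by
  obtain ⟨W, hW, hW0, hΩ⟩ := hΩ
  obtain ⟨U, hU, hU0, hφU⟩ := hφ
  have hφ : ∀ᶠ z in 𝓝 (0 : ℝ × ℝ), ContDiffAt ℝ r φ z := by
    filter_upwards [hU.mem_nhds hU0] with z hz using hφU.contDiffAt (hU.mem_nhds hz)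
  have hφd := hφ.self_of_nhds.differentiableAt (AkSingularity.ne_zero_of_infty_or_omega hr)
  have hne := AkSingularity.fderiv_fst_ne_zero hr hk (hΩ.density_ne_zero hW0) hφ.self_of_nhds hφ0
    hφΩ.self_of_nhds hφH
  refine ⟨fun hodd => ?_, fun heven => ⟨fun hinv => ?_, fun ha => ?_⟩⟩
  · exact AkSingularity.isTimeOneMapOfFunctionOf_of_odd hr hs hk hodd hW hW0 hΩ hφ hφ0 hφΩ hφH
      (lt_of_le_of_ne (AkSingularity.fderiv_fst_nonneg_of_odd hs hodd hφd hφ0 hφH) hne.symm)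
  · rcases hne.lt_or_gt with ha | ha
    -- For even `k`, `Inv` preserves `H` and, in this case, `ω`; composition with it makes the upper
    -- left entry of the differential positive.
    · right
      have h0 : AkSingularity.inv 0 = 0 := by simp [AkSingularity.inv]
      have hsm : ContDiff ℝ r AkSingularity.inv := contDiff_fst.neg.prodMk contDiff_snd.neg
      have ht : Tendsto AkSingularity.inv (𝓝 0) (𝓝 0) := by
        simpa only [h0] using hsm.continuous.tendsto 0
      refine AkSingularity.isTimeOneMapOfComponentwiseConst_of_pos hr hs hk hW hW0 hΩ ?_
        (by rw [Function.comp_apply, h0, hφ0]) ?_ ?_ ?_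
      · filter_upwards [ht.eventually hφ] with z hz using hz.comp z hsm.contDiffAt
      · filter_upwards [ht.eventually hφ, ht.eventually hφΩ, hinv] with z hz hΩz hi
        rw [AkSingularity.pullback_comp Ω
          (hz.differentiableAt (AkSingularity.ne_zero_of_infty_or_omega hr))
          (AkSingularity.hasFDerivAt_inv z).differentiableAt, AkSingularity.pullback_congr hΩz, hi]
      · filter_upwards [ht.eventually hφH] with z hz
        rw [Function.comp_apply, hz]
        simp only [AkSingularity.ham, AkSingularity.inv, heven.neg_pow, neg_sq]
      · have h := HasFDerivAt.comp (0 : ℝ × ℝ) (f := AkSingularity.inv)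
          (by rw [h0]; exact hφd.hasFDerivAt) (AkSingularity.hasFDerivAt_inv 0)
        rw [h.fderiv]
        simpa using ha
    · left
      exact AkSingularity.isTimeOneMapOfComponentwiseConst_of_pos hr hs hk hW hW0 hΩ hφ hφ0 hφΩ
        hφH ha
  · exact AkSingularity.isTimeOneMapOfComponentwiseConst_of_pos hr hs hk hW hW0 hΩ hφ hφ0 hφΩ hφH ha
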